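/- Let $(W,S)$ be a right-angled Coxeter system with $S$ finite (that is, $m_{st}\in\{2,\infty\}$ for $s\neq t$), and let $\Phi$ be a regular building of type $(W,S)$: a chamber system over $S$ in which every $s$-equivalence class has at least two chambers, with a $W$-valued distance function $\delta:\Phi\times\Phi\to W$ (for every reduced word $(s_1,\dots,s_k)$, two chambers $\phi,\phi'$ are joined by a gallery of type $(s_1,\dots,s_k)$ if and only if $\delta(\phi,\phi')=s_1\cdots s_k$), such that for each $s\in S$ all $s$-equivalence classes have the same cardinality $q_s$. Let $X$ be its geometric realization, obtained by gluing copies $\{\phi\}\times K$ of the geometric realization $K$ of the poset of spherical subsets of $S$ along mirrors. Equip $X$ with the length metric of its standard piecewise Euclidean structure, in which the realization of the subsets of a spherical set $T$ is a box $\prod_{s\in T}[0,\ell_s]$, where the side lengths $\ell_s>0$ $(s\in S)$ are arbitrary. The chambers of $X$ are the copies of $K$ in $X$; the center of a chamber is its vertex of type $\emptyset$; the apartments of $X$ are the subcomplexes that are unions of the chambers in the image of a map $W\to\Phi$ preserving $W$-distances, where $W$ carries the $W$-distance $(w,w')\mapsto w^{-1}w'$. Let $\operatorname{Aut}(X)$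 be the group of cellular isometries of $X$, and $\operatorname{Aut}_0(X)$ the subgroup of those which preserve the types of vertices. (1) For every chamber $Y_0$ of $X$ with center $x_0$, the group $\operatorname{Stab}_{\operatorname{Aut}_0(X)}(x_0)$ acts transitively on the set of apartments containing $Y_0$. (2) $\operatorname{Aut}_0(X)$ acts transitively on the set of pairs $(\phi,\Sigma)$, where $\phi$ is a chamber of $X$ and $\Sigma$ is an apartment of $X$ containing $\phi$. (3) Consequently $\operatorname{Aut}(X)$ is strongly transitive on $X$: for any two such pairs $(\phi,\Sigma)$ and $(\phi',\Sigma')$ there is $g\in\operatorname{Aut}(X)$ with $g\phi=\phi'$ and $g\Sigma=\Sigma'$. -/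

import Mathlib

open scoped ENNReal Pointwise

noncomputable section

universe u v w

/-- A Coxeter matrix is right-angled if `m s t ∈ {2, ∞}` for `s ≠ t`
(the value `∞` is encoded as `0`). -/
def CoxeterMatrix.IsRightAngled {S : Type u} (M : CoxeterMatrix S) : Prop :=
  ∀ s t : S, s ≠ t → M s t = 2 ∨ M s t = 0

/-- A chamber system over `S` with set of chambers `Φ`: one equivalence relation on `Φ` for
each `s : S`. -/
structure ChamberSystem (S : Type u) (Φ : Type w) where
  /-- `s`-equivalence of chambers -/
  equiv : S → Setoid Φ

namespace ChamberSystem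

variable {S : Type u} {Φ : Type w}

/-- Two chambers are `s`-adjacent if they are `s`-equivalent and not equal. -/
def Adjacent (C : ChamberSystem S Φ) (s : S) (φ ψ : Φ) : Prop :=
  C.equiv s φ ψ ∧ φ ≠ ψ

/-- `C.Joined φ l ψ`: there is a gallery of type `l` from `φ` to `ψ`. -/
def Joined (C : ChamberSystem S Φ) : Φ → List S → Φ → Prop
  | φ, [], ψ => φ = ψ
  | φ, s :: l, ψ => ∃ χ, C.Adjacent s φ χ ∧ C.Joined χ l ψ

/-- The equivalence relation on chambers whose classes are the residues of type `T`: it is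
generated by the `s`-equivalences with `s ∈ T`. -/
def residue (C : ChamberSystem S Φ) (T : Set S) : Setoid Φ :=
  ⨆ s ∈ T, C.equiv s

end ChamberSystem

/-- A building of type `(W, S)`, as a chamber system with a `W`-valued distance function. -/
structure Building {S : Type u} {M : CoxeterMatrix S} {W : Type v} [Group W]
    (cs : CoxeterSystem M W) (Φ : Type w) extends ChamberSystem S Φ where
  /-- each `s`-equivalence class contains at least two chambers -/
  exists_ne : ∀ (s : S) (φ : Φ), ∃ ψ, equiv s φ ψ ∧ ψ ≠ φ
  /-- the `W`-distance -/
  δ : Φ → Φ → W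
  /-- for a reduced word `l`, two chambers are joined by a gallery of type `l` if and only if their
  `W`-distance is the element of `W` represented by `l` -/
  joined_iff : ∀ l : List S, cs.IsReduced l → ∀ φ ψ : Φ,
    toChamberSystem.Joined φ l ψ ↔ δ φ ψ = cs.wordProd l

section Chamber

variable {S : Type u} {M : CoxeterMatrix S} {W : Type v} [Group W]

/-- A subset `T ⊆ S` is spherical if the special subgroup generated by `T` is finite. -/
def CoxeterSystem.IsSpherical (cs : CoxeterSystem M W) (T : Set S) : Prop :=
  Finite (Subgroup.closure (cs.simple '' T))

/-- The poset of spherical subsets of `S`, ordered by inclusion. -/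
abbrev CoxeterSystem.Spherical (cs : CoxeterSystem M W) : Type u :=
  {T : Set S // cs.IsSpherical T}

/-- The empty subset is spherical. -/
def CoxeterSystem.emptySpherical (cs : CoxeterSystem M W) : cs.Spherical :=
  ⟨∅, by
    unfold CoxeterSystem.IsSpherical
    rw [Set.image_empty, Subgroup.closure_empty]
    infer_instance⟩

/-- The model chamber `K`: the geometric realization of the poset of spherical subsets. A point is
given by its barycentric coordinates, whose support is a chain. -/
def CoxeterSystem.ModelChamber (cs : CoxeterSystem M W) : Type u :=
  {x : cs.Spherical →₀ ℝ //
    (∀ T, 0 ≤ x T) ∧ IsChain (· ≤ ·) (x.support : Set cs.Spherical) ∧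
      (x.sum fun _ a => a) = 1}

namespace CoxeterSystem.ModelChamber

variable {cs : CoxeterSystem M W}

/-- The vertex of type `T` of the model chamber. -/
def vertex (T : cs.Spherical) : cs.ModelChamber :=
  ⟨Finsupp.single T 1, fun T' => by classical rw [Finsupp.single_apply]; split_ifs <;> norm_num,
    by
      rw [Finsupp.support_single _ one_ne_zero, Finset.coe_singleton]
      exact IsChain.singleton,
    by simp⟩

/-- The closed simplex of the model chamber spanned by a set `c` of vertices. -/
def simplex (c : Set cs.Spherical) : Set cs.ModelChamber :=
  {x | (x.1.support : Set cs.Spherical) ⊆ c}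

/-- The `s`-mirror: the union of the closed simplices which contain the vertex of type `{s}` but
do not contain the cone point (the vertex of type `∅`). -/
def mirror (cs : CoxeterSystem M W) (s : S) : Set cs.ModelChamber :=
  {x | ∃ c : Set cs.Spherical, IsChain (· ≤ ·) c ∧ (∃ T ∈ c, T.1 = {s}) ∧
    cs.emptySpherical ∉ c ∧ x ∈ simplex c}

/-- `mirrorTypes x` is the set `S(x)` of those `s` for which `x` lies in the `s`-mirror. -/
def mirrorTypes (x : cs.ModelChamber) : Set S := {s | x ∈ mirror cs s}

open Classical in
/-- The map from the model chamber to `ℝ^S` which sends the vertex of type `T` to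
`∑ s ∈ T, ℓ s • e_s` and is affine on simplices. For a right-angled system it identifies the
subcomplex of vertices of type contained in a spherical `T` with the Euclidean box
`∏ s ∈ T, [0, ℓ s]`. -/
def coord [Fintype S] (ℓ : S → ℝ) (x : cs.ModelChamber) : EuclideanSpace ℝ S :=
  WithLp.toLp 2 fun s => x.1.sum fun T a => if s ∈ T.1 then a * ℓ s else 0

end CoxeterSystem.ModelChamber

end Chamber

open CoxeterSystem

namespace Building

variable {S : Type u} {M : CoxeterMatrix S} {W : Type v} [Group W] {cs : CoxeterSystem M W}
  {Φ : Type w}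

/-- A building is regular if, for every `s`, all `s`-equivalence classes of chambers have the same
cardinality. -/
def IsRegular (X : Building cs Φ) : Prop :=
  ∀ (s : S) (φ ψ : Φ),
    Cardinal.mk {χ : Φ // X.equiv s φ χ} = Cardinal.mk {χ : Φ // X.equiv s ψ χ}

/-- Gluing of the copies `{φ} × K` of the model chamber: `(φ, x) ∼ (ψ, y)` if and only if `x = y`
and `φ`, `ψ` lie in the same residue of type `S(x)`. -/
def gluing (X : Building cs Φ) : Setoid (Φ × cs.ModelChamber) where
  r p q := p.2 = q.2 ∧ X.residue p.2.mirrorTypes p.1 q.1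
  iseqv :=
    { refl := fun _ => ⟨rfl, Setoid.refl' _ _⟩
      symm := by
        rintro ⟨φ, x⟩ ⟨ψ, y⟩ ⟨h, h'⟩
        obtain rfl : x = y := h
        exact ⟨rfl, Setoid.symm' _ h'⟩
      trans := by
        rintro ⟨φ, x⟩ ⟨ψ, y⟩ ⟨χ, z⟩ ⟨h, h'⟩ ⟨k, k'⟩
        obtain rfl : x = y := h
        obtain rfl : x = z := k
        exact ⟨rfl, Setoid.trans' _ h' k'⟩ }

/-- The geometric realization of a building. -/
def Realization (X : Building cs Φ) : Type (max u w) := Quotient X.gluing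

/-- The point `[φ, x]` of the geometric realization. -/
def point (X : Building cs Φ) (φ : Φ) (x : cs.ModelChamber) : X.Realization :=
  Quotient.mk X.gluing (φ, x)

/-- The canonical map from the geometric realization to the model chamber, `[φ, x] ↦ x`. -/
def toModel (X : Building cs Φ) : X.Realization → cs.ModelChamber :=
  Quotient.lift (fun p => p.2) fun _ _ h => h.1

/-- The chamber of the geometric realization corresponding to `φ`. -/
def chamber (X : Building cs Φ) (φ : Φ) : Set X.Realization := Set.range (X.point φ)

/-- The center of the chamber corresponding to `φ`: its vertex of type `∅`. -/
def center (X : Building cs Φ) (φ : Φ) : X.Realization :=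
  X.point φ (ModelChamber.vertex cs.emptySpherical)

/-- The set of chambers of the geometric realization. -/
def chambers (X : Building cs Φ) : Set (Set X.Realization) := Set.range X.chamber

/-- The set of apartments of the geometric realization: the unions of the chambers in the image of
a map `f : W → Φ` preserving `W`-distances, where `W` has the `W`-distance `(w, w') ↦ w⁻¹ w'`. -/
def apartments (X : Building cs Φ) : Set (Set X.Realization) :=
  {A | ∃ f : W → Φ, (∀ w w', X.δ (f w) (f w') = w⁻¹ * w') ∧ A = ⋃ w, X.chamber (f w)}

/-- The set of pairs (chamber, apartment containing it). -/
def flags (X : Building cs Φ) : Set (Set X.Realization × Set X.Realization) :=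
  {p | p.1 ∈ X.chambers ∧ p.2 ∈ X.apartments ∧ p.1 ⊆ p.2}

/-- The closed simplices of the geometric realization. -/
def IsSimplex (X : Building cs Φ) (σ : Set X.Realization) : Prop :=
  ∃ (φ : Φ) (c : Set cs.Spherical), c.Nonempty ∧ IsChain (· ≤ ·) c ∧
    σ = X.point φ '' ModelChamber.simplex c

/-- `p` is a vertex of type `T` of the geometric realization. -/
def IsVertexOfType (X : Building cs Φ) (p : X.Realization) (T : cs.Spherical) : Prop :=
  ∃ φ, p = X.point φ (ModelChamber.vertex T)

/-- The length metric of the piecewise Euclidean structure with side lengths `ℓ`: the infimum of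
the lengths of the strings of points from `p` to `q`, where any two consecutive points of a string
lie in a common closed simplex and are at their Euclidean distance in that simplex. -/
def lengthDist [Fintype S] (X : Building cs Φ) (ℓ : S → ℝ) (p q : X.Realization) : ℝ≥0∞ :=
  ⨅ (n : ℕ) (x : ℕ → X.Realization) (_ : x 0 = p) (_ : x n = q)
    (_ : ∀ i < n, ∃ σ, X.IsSimplex σ ∧ x i ∈ σ ∧ x (i + 1) ∈ σ),
    ∑ i ∈ Finset.range n,
      edist ((X.toModel (x i)).coord ℓ) ((X.toModel (x (i + 1))).coord ℓ)

/-- `Aut(X)`: the group of cellular isometries of the geometric realization. -/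
def aut [Fintype S] (X : Building cs Φ) (ℓ : S → ℝ) : Subgroup (Equiv.Perm X.Realization) where
  carrier := {g | (∀ p q, X.lengthDist ℓ (g p) (g q) = X.lengthDist ℓ p q) ∧
    ∀ σ, X.IsSimplex (g • σ) ↔ X.IsSimplex σ}
  one_mem' := ⟨fun _ _ => rfl, fun σ => by rw [one_smul]⟩
  mul_mem' := by
    rintro g h ⟨hg, hg'⟩ ⟨hh, hh'⟩
    exact ⟨fun p q => (hg _ _).trans (hh _ _), fun σ => by rw [mul_smul, hg', hh']⟩
  inv_mem' := by
    rintro g ⟨hg, hg'⟩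
    refine ⟨fun p q => ?_, fun σ => ?_⟩
    · have := hg (g⁻¹ p) (g⁻¹ q)
      simpa using this.symm
    · rw [← hg', smul_inv_smul]

/-- `Aut₀(X)`: the group of type-preserving cellular isometries of the geometric realization. -/
def aut₀ [Fintype S] (X : Building cs Φ) (ℓ : S → ℝ) : Subgroup (Equiv.Perm X.Realization) where
  carrier := {g | g ∈ X.aut ℓ ∧ ∀ p T, X.IsVertexOfType (g p) T ↔ X.IsVertexOfType p T}
  one_mem' := ⟨one_mem _, fun _ _ => Iff.rfl⟩
  mul_mem' := by
    rintro g h ⟨hg, hg'⟩ ⟨hh, hh'⟩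
    exact ⟨mul_mem hg hh, fun p T => (hg' _ _).trans (hh' _ _)⟩
  inv_mem' := by
    rintro g ⟨hg, hg'⟩
    refine ⟨inv_mem hg, fun p T => ?_⟩
    simpa using (hg' (g⁻¹ p) T).symm

end Building

/-- Any two elements of `F` are related by an element of the subgroup `H`. -/
def Subgroup.TransitiveOn {G : Type*} {α : Type*} [Group G] [MulAction G α]
    (H : Subgroup G) (F : Set α) : Prop :=
  ∀ a ∈ F, ∀ b ∈ F, ∃ h ∈ H, h • a = b

/-- The subgroup `H` maps `F` into itself, and any two elements of `F` are related by an element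
of `H`. -/
def Subgroup.ActsTransitivelyOn {G : Type*} {α : Type*} [Group G] [MulAction G α]
    (H : Subgroup G) (F : Set α) : Prop :=
  (∀ h ∈ H, ∀ a ∈ F, h • a ∈ F) ∧ H.TransitiveOn F

end

/-! Automorphisms of the chamber system induce type-preserving cellular isometries, and conversely
such an isometry permutes the centers and so comes with a chamber automorphism. All three claims
therefore reduce to `exists_perm_comp_eq`: two `W`-isometric images of `W` in a regular right-angled
building differ by a chamber automorphism.

For each `s` the chambers are given labels, bijectively on every `s`-class, unchanged on passing to
a `t`-equivalent chamber with `t` commuting with `s`, and with a fixed label on the chambers nearest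
to a base chamber (`exists_isLabelling`). Regularity allows one label set for all `s`-classes and
both base chambers. The automorphism sends the end of a minimal gallery from one base chamber to the
end of the gallery with the same types and labels from the other. This does not depend on the
gallery (`Corresponds.unique_right`): if two last steps have distinct types `s` and `t`, both are
right descents of the distance, hence commute (`eq_two_of_isRightDescent`), and they are sides of a
square whose opposite sides carry the same labels. Exchanging the base chambers gives the inverse.
Prescribing the labels along the two apartments makes them correspond.

The facts on descents come from an action of `W` on `W × ZMod 2` which records inversions. -/

noncomputable section

/-! ### Descents and exchange in right-angled Coxeter groups -/

namespace CoxeterSystem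

variable {S : Type*} {M : CoxeterMatrix S} {W : Type*} [Group W]

/-- In a right-angled system there is a homomorphism counting the letters `s` modulo two. -/
theorem exists_letterParity (hM : M.IsRightAngled) (cs : CoxeterSystem M W) (s : S) :
    ∃ ε : W →* Multiplicative (ZMod 2), ε (cs.simple s) ≠ 1 ∧
      ∀ t, t ≠ s → ε (cs.simple t) = 1 := by
  classical
  have hsq : ∀ x : Multiplicative (ZMod 2), x ^ 2 = 1 := by decide
  have hlift : M.IsLiftable
      (fun t => if t = s then Multiplicative.ofAdd (1 : ZMod 2) else 1) := by
    intro t u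
    by_cases h : t = u
    · subst h
      rw [M.diagonal, pow_one, ← sq, hsq]
    · rcases hM t u h with h | h <;> rw [h]
      · exact hsq _
      · exact pow_zero _
  refine ⟨cs.lift ⟨_, hlift⟩, ?_, fun t ht => ?_⟩
  · rw [cs.lift_apply_simple hlift, if_pos rfl]
    decide
  · rw [cs.lift_apply_simple hlift, if_neg ht]

/-- The letter parity takes values in an abelian group, so it cannot separate conjugate elements. -/
theorem eq_of_simple_mul_eq_mul_simple (hM : M.IsRightAngled) (cs : CoxeterSystem M W) {s t : S}
    {w : W} (h : cs.simple s * w = w * cs.simple t) : s = t := by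
  obtain ⟨ε, h₁, h₂⟩ := cs.exists_letterParity hM s
  by_contra hne
  have := congrArg ε h
  rw [map_mul, map_mul, mul_comm, h₂ t (Ne.symm hne)] at this
  exact h₁ (mul_left_cancel this)

theorem simple_injective (hM : M.IsRightAngled) (cs : CoxeterSystem M W) :
    Function.Injective cs.simple := fun s t h =>
  cs.eq_of_simple_mul_eq_mul_simple hM (w := 1) (by rw [h, mul_one, one_mul])

theorem simple_mul_comm (cs : CoxeterSystem M W) {s t : S} (h : M s t = 2) :
    cs.simple s * cs.simple t = cs.simple t * cs.simple s := by
  have := cs.simple_mul_simple_pow s t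
  rw [h, sq] at this
  rw [eq_inv_of_mul_eq_one_left this]
  simp

/-- If `m s t = ∞` in a right-angled system then `s t` has infinite order. -/
theorem eq_zero_of_simple_mul_simple_pow (hM : M.IsRightAngled) (cs : CoxeterSystem M W) {s t : S}
    (hst : s ≠ t) (h : M s t = 0) {n : ℕ} (hn : (cs.simple s * cs.simple t) ^ n = 1) :
    n = 0 := by
  classical
  -- `DihedralGroup 0` is the infinite dihedral group; `s` and `t` go to reflections whose product
  -- is a generating rotation, all other letters to `1`.
  let f : S → DihedralGroup 0 := fun u =>
    if u = s then DihedralGroup.sr 0 else if u = t then DihedralGroup.sr 1 else 1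
  have hsq : ∀ u, f u * f u = 1 := by
    intro u
    simp only [f]
    split_ifs <;> simp
  have hlift : M.IsLiftable f := by
    intro u v
    by_cases huv : u = v
    · subst huv
      rw [M.diagonal, pow_one, hsq]
    rcases hM u v huv with h' | h'
    · rw [h']
      by_cases hu : u = s ∨ u = t
      · by_cases hv : v = s ∨ v = t
        · have h'' : M v u = 2 := by rw [M.symmetric]; exact h'
          rcases hu with rfl | rfl <;> rcases hv with rfl | rfl <;> simp_all
        · have : f v = 1 := by
            rw [not_or] at hv
            simp [f, hv.1, hv.2]
          rw [this, mul_one, sq, hsq]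
      · have : f u = 1 := by
          rw [not_or] at hu
          simp [f, hu.1, hu.2]
        rw [this, one_mul, sq, hsq]
    · rw [h', pow_zero]
  have := congrArg (cs.lift ⟨f, hlift⟩) hn
  rw [map_pow, map_mul, cs.lift_apply_simple hlift, cs.lift_apply_simple hlift, map_one] at this
  have hs : f s = DihedralGroup.sr 0 := if_pos rfl
  have ht : f t = DihedralGroup.sr 1 := by simp [f, hst.symm]
  rw [hs, ht, DihedralGroup.sr_mul_sr, sub_zero, DihedralGroup.r_one_pow, DihedralGroup.one_def,
    DihedralGroup.r.injEq] at this
  exact_mod_cast this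

open Classical in
/-- The involution of `W × ZMod 2` which conjugates the first component by `s` and changes the
second one at `s`. -/
def inversionInvolution (cs : CoxeterSystem M W) (s : S) : Equiv.Perm (W × ZMod 2) :=
  Function.Involutive.toPerm
    (fun p => (cs.simple s * p.1 * cs.simple s, p.2 + if p.1 = cs.simple s then 1 else 0)) (by
      rintro ⟨x, e⟩
      have h : cs.simple s * x * cs.simple s = cs.simple s ↔ x = cs.simple s := by
        rw [mul_eq_right, ← inv_eq_iff_mul_eq_one, cs.inv_simple, eq_comm]
      have h2 : (1 : ZMod 2) + 1 = 0 := by decide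
      ext
      · simp [mul_assoc]
      · by_cases hx : x = cs.simple s <;> simp [h, hx, add_assoc, h2])

open Classical in
theorem inversionInvolution_apply (cs : CoxeterSystem M W) (s : S) (x : W) (e : ZMod 2) :
    cs.inversionInvolution s (x, e) =
      (cs.simple s * x * cs.simple s, e + if x = cs.simple s then 1 else 0) := rfl

/-- Only `m = 2` needs work: conjugation by commuting generators fixes both of them, so each of the
two sign changes happens twice and cancels. -/
theorem isLiftable_inversionInvolution (hM : M.IsRightAngled) (cs : CoxeterSystem M W) :
    M.IsLiftable cs.inversionInvolution := by
  classical
  intro s t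
  by_cases hst : s = t
  · subst hst
    rw [M.diagonal, pow_one]
    exact Equiv.ext fun p => Function.Involutive.toPerm_involutive _ p
  rcases hM s t hst with h | h
  · rw [h, sq]
    have hc := cs.simple_mul_comm h
    have h1 : ∀ x, cs.simple t * x * cs.simple t = cs.simple s ↔ x = cs.simple s := by
      intro x
      rw [← eq_mul_inv_iff_mul_eq, cs.inv_simple, hc, mul_right_inj]
    have h2 : ∀ x, cs.simple s * (cs.simple t * x * cs.simple t) * cs.simple s = cs.simple t ↔
        x = cs.simple t := by
      intro x
      rw [← eq_mul_inv_iff_mul_eq, cs.inv_simple, ← hc, mul_right_inj, mul_eq_right,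
        ← inv_eq_iff_mul_eq_one, cs.inv_simple, eq_comm]
    have h3 : ∀ x, cs.simple s * (cs.simple t * x * cs.simple t) * cs.simple s = cs.simple s ↔
        x = cs.simple s := by
      intro x
      rw [mul_eq_right, ← inv_eq_iff_mul_eq_one, cs.inv_simple, eq_comm, h1]
    ext ⟨x, e⟩ : 1
    simp only [Equiv.Perm.mul_apply, inversionInvolution_apply, h1, h2, h3, Equiv.Perm.one_apply,
      Prod.mk.injEq]
    constructor
    · have : cs.simple s * (cs.simple t * (cs.simple s * (cs.simple t * x * cs.simple t) *
          cs.simple s) * cs.simple t) * cs.simple s =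
          (cs.simple s * cs.simple t * (cs.simple s * cs.simple t)) * x *
            (cs.simple t * cs.simple s * (cs.simple t * cs.simple s)) := by
        simp only [mul_assoc]
      rw [this, ← hc]
      have h4 := cs.simple_mul_simple_pow s t
      rw [h, sq] at h4
      rw [h4, one_mul, mul_one]
    · have h4 : ∀ a b c : ZMod 2, a + b + c + b + c = a := by decide
      exact h4 _ _ _
  · rw [h, pow_zero]

/-- The action of a right-angled Coxeter group on `W × ZMod 2` which records inversions. -/
def inversionAction (hM : M.IsRightAngled) (cs : CoxeterSystem M W) :
    W →* Equiv.Perm (W × ZMod 2) :=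
  cs.lift ⟨cs.inversionInvolution, cs.isLiftable_inversionInvolution hM⟩

open Classical in
theorem inversionAction_simple (hM : M.IsRightAngled) (cs : CoxeterSystem M W) (s : S) (x : W)
    (e : ZMod 2) : cs.inversionAction hM (cs.simple s) (x, e) =
      (cs.simple s * x * cs.simple s, e + if x = cs.simple s then 1 else 0) := by
  rw [inversionAction, cs.lift_apply_simple]
  rfl

theorem inversionAction_wordProd (hM : M.IsRightAngled) (cs : CoxeterSystem M W) {l : List S}
    {x : W} (hx : x ∉ cs.rightInvSeq l) (e : ZMod 2) :
    cs.inversionAction hM (cs.wordProd l) (x, e) =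
      (cs.wordProd l * x * (cs.wordProd l)⁻¹, e) := by
  induction l with
  | nil => simp
  | cons i l ih =>
    rw [rightInvSeq, List.mem_cons, not_or] at hx
    rw [wordProd_cons, map_mul, Equiv.Perm.mul_apply, ih hx.2, inversionAction_simple, if_neg]
    · simp [mul_assoc]
    · rintro h
      apply hx.1
      rw [← h]
      group

theorem mem_rightInvSeq_of_inversionAction (hM : M.IsRightAngled) (cs : CoxeterSystem M W)
    {l : List S} {x : W} (h : (cs.inversionAction hM (cs.wordProd l) (x, 0)).2 ≠ 0) :
    x ∈ cs.rightInvSeq l := by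
  by_contra hx
  rw [cs.inversionAction_wordProd hM hx] at h
  exact h rfl

theorem inversionAction_snd_add (hM : M.IsRightAngled) (cs : CoxeterSystem M W) (w x : W)
    (e : ZMod 2) : (cs.inversionAction hM w (x, e)).2 = (cs.inversionAction hM w (x, 0)).2 + e ∧
      (cs.inversionAction hM w (x, e)).1 = (cs.inversionAction hM w (x, 0)).1 := by
  classical
  induction w using cs.simple_induction_left with
  | one => simp
  | mul_simple_left w i ih =>
    rw [map_mul, Equiv.Perm.mul_apply, Equiv.Perm.mul_apply,
      ← Prod.mk.eta (p := cs.inversionAction hM w (x, e)),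
      ← Prod.mk.eta (p := cs.inversionAction hM w (x, 0)), ih.1, ih.2,
      inversionAction_simple, inversionAction_simple]
    exact ⟨by ring, rfl⟩

/-- A sign change puts `s` in the inversion sequence of a reduced word, which makes it a descent. If
there were no sign change for a descent `s` of `w`, there would be one for `w * s`, which would then
also have the descent `s`. -/
theorem isRightDescent_iff_inversionAction (hM : M.IsRightAngled) (cs : CoxeterSystem M W) (w : W)
    (s : S) :
    cs.IsRightDescent w s ↔ (cs.inversionAction hM w (cs.simple s, 0)).2 ≠ 0 := by
  have key : ∀ w : W, (cs.inversionAction hM w (cs.simple s, 0)).2 ≠ 0 →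
      cs.IsRightDescent w s := by
    intro w hw
    obtain ⟨l, hl, rfl⟩ := cs.exists_isReduced w
    rw [← isRightInversion_simple_iff_isRightDescent]
    exact cs.isRightInversion_of_mem_rightInvSeq hl (cs.mem_rightInvSeq_of_inversionAction hM hw)
  refine ⟨fun h h0 => ?_, key w⟩
  rw [cs.isRightDescent_iff_not_isRightDescent_mul] at h
  apply h
  apply key
  rw [map_mul, Equiv.Perm.mul_apply, inversionAction_simple, if_pos rfl, zero_add,
    cs.simple_mul_simple_self, one_mul, (cs.inversionAction_snd_add hM _ _ _).1, h0, zero_add]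
  decide

theorem exists_eq_append_of_mem_rightInvSeq (cs : CoxeterSystem M W) {l : List S} {x : W}
    (hx : x ∈ cs.rightInvSeq l) :
    ∃ a r b, l = a ++ r :: b ∧ cs.simple r * cs.wordProd b = cs.wordProd b * x := by
  induction l with
  | nil => simp at hx
  | cons i l ih =>
    rw [rightInvSeq, List.mem_cons] at hx
    rcases hx with rfl | hx
    · exact ⟨[], i, l, rfl, by group⟩
    · obtain ⟨a, r, b, rfl, h⟩ := ih hx
      exact ⟨i :: a, r, b, rfl, h⟩

/-- The exchange property for right-angled Coxeter systems: the letter which is exchanged for `s`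
is `s` itself. -/
theorem exists_eq_append_of_isRightDescent (hM : M.IsRightAngled) (cs : CoxeterSystem M W)
    {l : List S} {s : S} (h : cs.IsRightDescent (cs.wordProd l) s) :
    ∃ a b, l = a ++ s :: b ∧ cs.simple s * cs.wordProd b = cs.wordProd b * cs.simple s := by
  obtain ⟨a, r, b, hl, hb⟩ := cs.exists_eq_append_of_mem_rightInvSeq
    (cs.mem_rightInvSeq_of_inversionAction hM
      ((cs.isRightDescent_iff_inversionAction hM _ _).1 h))
  obtain rfl := cs.eq_of_simple_mul_eq_mul_simple hM hb
  exact ⟨a, b, hl, hb⟩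

/-- The generator `t` fixes the pair `(s, 0)`, so `w` and `w * t` act on it in the same way. -/
theorem isRightDescent_mul_simple_iff (hM : M.IsRightAngled) (cs : CoxeterSystem M W) {s t : S}
    (h : M s t = 2) (w : W) :
    cs.IsRightDescent (w * cs.simple t) s ↔ cs.IsRightDescent w s := by
  have hst : s ≠ t := by
    rintro rfl
    rw [M.diagonal] at h
    omega
  rw [isRightDescent_iff_inversionAction hM, isRightDescent_iff_inversionAction hM, map_mul,
    Equiv.Perm.mul_apply, inversionAction_simple, if_neg fun h' => hst (cs.simple_injective hM h'),
    add_zero, ← cs.simple_mul_comm h, mul_assoc, cs.simple_mul_simple_self, mul_one]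

/-- Alternating words are normalized by their last letter `q`, which a nonempty suffix keeps. -/
theorem eq_alternatingWord_of_append_eq {p q : S} {k : ℕ} {a b : List S}
    (h : a ++ b = alternatingWord p q k) : b = alternatingWord p q b.length := by
  induction k generalizing a with
  | zero =>
    obtain ⟨rfl, rfl⟩ := List.append_eq_nil_iff.1 h
    rfl
  | succ k ih =>
    cases a with
    | nil =>
      have : b.length = k + 1 := by
        rw [← length_alternatingWord p q (k + 1), ← h, List.nil_append]
      rw [this, ← h, List.nil_append]
    | cons x a =>
      rw [alternatingWord_succ', List.cons_append, List.cons.injEq] at h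
      exact ih h.2

/-- Here `b` has odd length and both ends `q`, so commuting with `p` would equate a positive power
of `p q` with its inverse. -/
theorem simple_mul_wordProd_ne_of_alternatingWord (hM : M.IsRightAngled) (cs : CoxeterSystem M W)
    {p q : S} (hne : p ≠ q) (hpq : M p q = 0) {k : ℕ} {a b : List S}
    (h : alternatingWord p q k = a ++ p :: b) :
    cs.simple p * cs.wordProd b ≠ cs.wordProd b * cs.simple p := by
  intro hb
  have h1 := eq_alternatingWord_of_append_eq h.symm
  have h2 : b = alternatingWord p q b.length :=
    eq_alternatingWord_of_append_eq (k := k) (a := a ++ [p]) (by rw [h]; simp)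
  rw [List.length_cons, alternatingWord_succ', List.cons.injEq] at h1
  by_cases hev : Even b.length
  · rw [if_pos hev] at h1
    exact hne h1.1
  · rw [h2, prod_alternatingWord_eq_mul_pow, if_neg hev, ← mul_assoc, ← pow_succ',
      ← mul_pow_mul, mul_assoc, ← pow_succ] at hb
    have hinv : cs.simple q * cs.simple p = (cs.simple p * cs.simple q)⁻¹ := by simp
    have h3 : (cs.simple p * cs.simple q) ^ (b.length / 2 + 1 + (b.length / 2 + 1)) = 1 := by
      rw [pow_add]
      nth_rw 2 [hb]
      rw [hinv, inv_pow, mul_inv_cancel]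
    have := cs.eq_zero_of_simple_mul_simple_pow hM hne hpq h3
    omega

/-- Two distinct right descents of an element of a right-angled Coxeter group commute. -/
theorem eq_two_of_isRightDescent (hM : M.IsRightAngled) (cs : CoxeterSystem M W) {s t : S}
    (hst : s ≠ t) {w : W} (hs : cs.IsRightDescent w s) (ht : cs.IsRightDescent w t) :
    M s t = 2 := by
  refine (hM s t hst).resolve_right fun h0 => ?_
  -- If `s` and `t` did not commute, `w` would have reduced words ending in arbitrarily long
  -- alternating words: the exchanged letter `p` cannot lie in the alternating tail, so it comes
  -- from `c` and moves to the end.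
  have key : ∀ k : ℕ, ∃ p q, M p q = 0 ∧ p ≠ q ∧ cs.IsRightDescent w p ∧ cs.IsRightDescent w q ∧
      ∃ c, w = cs.wordProd (c ++ alternatingWord p q k) ∧ cs.length w = c.length + k := by
    intro k
    induction k with
    | zero =>
      obtain ⟨c, hc, rfl⟩ := cs.exists_isReduced w
      exact ⟨s, t, h0, hst, hs, ht, c, by simp [alternatingWord], hc⟩
    | succ k ih =>
      obtain ⟨p, q, hpq, hne, hp, hq, c, hw, hl⟩ := ih
      refine ⟨q, p, by rw [M.symmetric]; exact hpq, hne.symm, hq, hp, ?_⟩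
      rw [hw] at hp
      obtain ⟨a, b, hab, hb⟩ := cs.exists_eq_append_of_isRightDescent hM hp
      rcases List.append_eq_append_iff.1 hab with ⟨a', ha, ha'⟩ | ⟨c', hc, hc'⟩
      · exact absurd hb (cs.simple_mul_wordProd_ne_of_alternatingWord hM hne hpq ha')
      · cases c' with
        | nil => exact absurd hb (cs.simple_mul_wordProd_ne_of_alternatingWord (a := []) hM hne hpq
            hc'.symm)
        | cons x c' =>
          rw [List.cons_append, List.cons.injEq] at hc'
          obtain ⟨rfl, rfl⟩ := hc'
          refine ⟨a ++ c', ?_, ?_⟩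
          · rw [hw, hab, alternatingWord_succ, List.append_assoc, wordProd_append, wordProd_cons, hb,
              wordProd_append, wordProd_append, wordProd_append, wordProd_concat]
            simp only [mul_assoc]
          · rw [hl, hc]
            simp only [List.length_append, List.length_cons]
            omega
  obtain ⟨p, q, -, -, -, -, c, -, hl⟩ := key (cs.length w + 1)
  omega

end CoxeterSystem

/-! ### Galleries and residues -/

namespace ChamberSystem

variable {S : Type*} {Φ : Type*}

theorem joined_append (C : ChamberSystem S Φ) {φ ψ : Φ} {l l' : List S} :
    C.Joined φ (l ++ l') ψ ↔ ∃ χ, C.Joined φ l χ ∧ C.Joined χ l' ψ := by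
  induction l generalizing φ with
  | nil => simp [Joined]
  | cons s l ih =>
    simp only [List.cons_append, Joined, ih]
    constructor
    · rintro ⟨ρ, h, χ, h', h''⟩
      exact ⟨χ, ⟨ρ, h, h'⟩, h''⟩
    · rintro ⟨χ, ⟨ρ, h, h'⟩, h''⟩
      exact ⟨ρ, h, χ, h', h''⟩

theorem joined_singleton (C : ChamberSystem S Φ) {φ ψ : Φ} {s : S} :
    C.Joined φ [s] ψ ↔ C.Adjacent s φ ψ := by
  simp [Joined]

theorem joined_map_iff (C : ChamberSystem S Φ) (g : Equiv.Perm Φ)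
    (hg : ∀ s φ ψ, C.equiv s (g φ) (g ψ) ↔ C.equiv s φ ψ) {l : List S} {φ ψ : Φ} :
    C.Joined (g φ) l (g ψ) ↔ C.Joined φ l ψ := by
  induction l generalizing φ with
  | nil => exact g.injective.eq_iff
  | cons s l ih =>
    refine g.surjective.exists.trans (exists_congr fun χ => and_congr ?_ ih)
    exact and_congr (hg s φ χ) g.injective.ne_iff

theorem equiv_le_residue (C : ChamberSystem S Φ) {T : Set S} {s : S} (hs : s ∈ T) {φ ψ : Φ}
    (h : C.equiv s φ ψ) : C.residue T φ ψ :=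
  (le_iSup₂ (f := fun s (_ : s ∈ T) => C.equiv s) s hs) h

/-- Chambers in a residue are joined by a sequence of equivalences of the given types. -/
theorem residue_iff (C : ChamberSystem S Φ) {T : Set S} {φ ψ : Φ} :
    C.residue T φ ψ ↔ Relation.ReflTransGen (fun a b => ∃ t ∈ T, C.equiv t a b) φ ψ := by
  constructor
  · let r : Setoid Φ :=
      { r := Relation.ReflTransGen (fun a b => ∃ t ∈ T, C.equiv t a b)
        iseqv :=
          { refl := fun _ => Relation.ReflTransGen.refl
            symm := fun h => by
              induction h with
              | refl => exact Relation.ReflTransGen.refl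
              | tail _ h ih =>
                obtain ⟨t, ht, h⟩ := h
                exact Relation.ReflTransGen.head ⟨t, ht, (C.equiv t).symm h⟩ ih
            trans := fun h h' => h.trans h' } }
    have : C.residue T ≤ r := iSup₂_le fun t ht a b h => Relation.ReflTransGen.single ⟨t, ht, h⟩
    exact fun h => this h
  · intro h
    induction h with
    | refl => exact Setoid.refl' _ _
    | tail _ h ih =>
      obtain ⟨t, ht, h⟩ := h
      exact Setoid.trans' _ ih (C.equiv_le_residue ht h)

theorem residue_singleton (C : ChamberSystem S Φ) (s : S) : C.residue {s} = C.equiv s := by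
  simp [residue]

theorem residue_empty (C : ChamberSystem S Φ) : C.residue ∅ = ⊥ := by
  simp [residue]

theorem residue_map_iff (C : ChamberSystem S Φ) (g : Equiv.Perm Φ)
    (hg : ∀ s φ ψ, C.equiv s (g φ) (g ψ) ↔ C.equiv s φ ψ) {T : Set S} {φ ψ : Φ} :
    C.residue T (g φ) (g ψ) ↔ C.residue T φ ψ := by
  have key : ∀ (g : Equiv.Perm Φ), (∀ s φ ψ, C.equiv s (g φ) (g ψ) ↔ C.equiv s φ ψ) →
      ∀ {φ ψ : Φ}, C.residue T φ ψ → C.residue T (g φ) (g ψ) := by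
    intro g hg φ ψ h
    rw [residue_iff] at h
    induction h with
    | refl => exact Setoid.refl' _ _
    | tail _ h ih =>
      obtain ⟨t, ht, h⟩ := h
      exact Setoid.trans' _ ih (C.equiv_le_residue ht ((hg t _ _).2 h))
  refine ⟨fun h => ?_, key g hg⟩
  have := key g⁻¹ (fun s φ ψ => by
    rw [← hg s (g⁻¹ φ)]
    simp) h
  simpa using this

/-- Parallelism in direction `s`: `s`-equivalence followed by equivalence in a residue whose types
commute with `s`. -/
def Parallel (C : ChamberSystem S Φ) (M : CoxeterMatrix S) (s : S) (φ ψ : Φ) : Prop :=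
  ∃ χ, C.equiv s φ χ ∧ C.residue {t | M s t = 2} χ ψ

end ChamberSystem

/-! ### The `W`-distance and nearest chambers in `s`-classes -/

namespace Building

variable {S : Type*} {M : CoxeterMatrix S} {W : Type*} [Group W] {cs : CoxeterSystem M W}
  {Φ : Type*} (X : Building cs Φ)

theorem δ_eq_one_iff {φ ψ : Φ} : X.δ φ ψ = 1 ↔ φ = ψ := by
  have := X.joined_iff [] (by simp [CoxeterSystem.IsReduced]) φ ψ
  rw [cs.wordProd_nil] at this
  exact this.symm

theorem δ_self (φ : Φ) : X.δ φ φ = 1 := X.δ_eq_one_iff.2 rfl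

theorem δ_map (g : Equiv.Perm Φ) (hg : ∀ s φ ψ, X.equiv s (g φ) (g ψ) ↔ X.equiv s φ ψ) (φ ψ : Φ) :
    X.δ (g φ) (g ψ) = X.δ φ ψ := by
  obtain ⟨l, hl, h⟩ := cs.exists_isReduced (X.δ φ ψ)
  rw [h, ← X.joined_iff l hl, X.joined_map_iff g hg, X.joined_iff l hl, h]

theorem isReduced_concat {l : List S} {s : S} (hl : cs.IsReduced l)
    (hs : ¬cs.IsRightDescent (cs.wordProd l) s) : cs.IsReduced (l ++ [s]) := by
  rw [cs.not_isRightDescent_iff, hl.eq] at hs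
  rw [CoxeterSystem.IsReduced, cs.wordProd_append, cs.wordProd_singleton, hs]
  simp

variable {X}

/-- A gallery of reduced type from `φ` to `ψ`, extended by the step to `χ`, still has reduced type.
-/
theorem δ_eq_mul_of_not_isRightDescent {s : S} {φ ψ χ : Φ} (h : X.equiv s ψ χ) (hne : ψ ≠ χ)
    (hs : ¬cs.IsRightDescent (X.δ φ ψ) s) : X.δ φ χ = X.δ φ ψ * cs.simple s := by
  obtain ⟨l, hl, hlw⟩ := cs.exists_isReduced (X.δ φ ψ)
  rw [hlw] at hs
  have hj := (X.joined_iff l hl φ ψ).2 hlw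
  rw [hlw, ← cs.wordProd_singleton, ← cs.wordProd_append,
    ← X.joined_iff _ (isReduced_concat hl hs), X.joined_append]
  exact ⟨ψ, hj, X.joined_singleton.2 ⟨h, hne⟩⟩

theorem isRightDescent_of_not_isRightDescent {s : S} {φ ψ χ : Φ} (h : X.equiv s ψ χ) (hne : ψ ≠ χ)
    (hs : ¬cs.IsRightDescent (X.δ φ ψ) s) : cs.IsRightDescent (X.δ φ χ) s := by
  rw [δ_eq_mul_of_not_isRightDescent h hne hs]
  rwa [cs.isRightDescent_iff_not_isRightDescent_mul, cs.simple_mul_simple_cancel_right]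

/-- The chamber of an `s`-class at minimal distance from `φ` is unique. -/
theorem eq_of_not_isRightDescent {s : S} {φ ψ χ : Φ} (h : X.equiv s ψ χ)
    (hψ : ¬cs.IsRightDescent (X.δ φ ψ) s) (hχ : ¬cs.IsRightDescent (X.δ φ χ) s) : ψ = χ := by
  by_contra hne
  exact hχ (isRightDescent_of_not_isRightDescent h hne hψ)

variable (X) in
/-- Every `s`-class contains a chamber at minimal distance from `φ`. -/
theorem exists_not_isRightDescent (s : S) (φ ψ : Φ) :
    ∃ χ, X.equiv s ψ χ ∧ ¬cs.IsRightDescent (X.δ φ χ) s := by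
  by_cases hs : cs.IsRightDescent (X.δ φ ψ) s
  · rw [cs.isRightDescent_iff_not_isRightDescent_mul] at hs
    obtain ⟨l, hl, hlw⟩ := cs.exists_isReduced (X.δ φ ψ * cs.simple s)
    have hs' := hs
    rw [hlw] at hs'
    have h : X.δ φ ψ = cs.wordProd (l ++ [s]) := by
      rw [cs.wordProd_append, cs.wordProd_singleton, ← hlw, cs.simple_mul_simple_cancel_right]
    rw [← X.joined_iff _ (isReduced_concat hl hs'), X.joined_append] at h
    obtain ⟨χ, hχ, hχ'⟩ := h
    refine ⟨χ, (X.equiv s).symm (X.joined_singleton.1 hχ').1, ?_⟩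
    rwa [(X.joined_iff l hl φ χ).1 hχ, ← hlw]
  · exact ⟨ψ, Setoid.refl' _ _, hs⟩

theorem δ_eq_or {s : S} {φ ψ χ : Φ} (h : X.equiv s ψ χ) :
    X.δ φ χ = X.δ φ ψ ∨ X.δ φ χ = X.δ φ ψ * cs.simple s := by
  obtain ⟨ρ, hρ, hs⟩ := X.exists_not_isRightDescent s φ ψ
  by_cases h1 : ρ = ψ
  · subst h1
    by_cases h2 : ρ = χ
    · exact Or.inl (by rw [h2])
    · exact Or.inr (δ_eq_mul_of_not_isRightDescent h h2 hs)
  · have h3 := δ_eq_mul_of_not_isRightDescent ((X.equiv s).symm hρ) h1 hs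
    by_cases h2 : ρ = χ
    · exact Or.inr (by rw [h3, h2, cs.simple_mul_simple_cancel_right])
    · refine Or.inl ?_
      rw [h3, δ_eq_mul_of_not_isRightDescent ((X.equiv s).trans ((X.equiv s).symm hρ) h) h2 hs]

theorem δ_eq_simple {s : S} {φ ψ : Φ} (h : X.equiv s φ ψ) (hne : φ ≠ ψ) :
    X.δ φ ψ = cs.simple s := by
  have := δ_eq_mul_of_not_isRightDescent (φ := φ) h hne
    (by rw [X.δ_self]; exact cs.not_isRightDescent_one s)
  rwa [X.δ_self, one_mul] at this

/-- Chambers at `W`-distances differing by `s` along a `W`-isometric image of `W`. -/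
theorem equiv_of_isometry {f : W → Φ} (hf : ∀ w w', X.δ (f w) (f w') = w⁻¹ * w') (w : W) (s : S) :
    X.equiv s (f w) (f (w * cs.simple s)) := by
  have h : X.δ (f w) (f (w * cs.simple s)) = cs.wordProd [s] := by
    rw [hf, cs.wordProd_singleton]
    group
  rw [← X.joined_iff [s] (by simp [CoxeterSystem.IsReduced]), X.joined_singleton] at h
  exact h.1

/-! ### Squares and parallelism in right-angled buildings -/

section RightAngled

variable (hM : M.IsRightAngled)
include hM

/-- The reduced words `ts` and `st` have the same product, so a gallery of one type can be traded
for one of the other. -/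
theorem exists_square {s t : S} (hst : M s t = 2) {φ ψ χ : Φ} (h : X.equiv t φ ψ)
    (h' : X.equiv s ψ χ) : ∃ ρ, X.equiv s φ ρ ∧ X.equiv t ρ χ := by
  have hne : s ≠ t := by
    rintro rfl
    rw [M.diagonal] at hst
    omega
  by_cases h1 : φ = ψ
  · subst h1
    exact ⟨χ, h', Setoid.refl' _ _⟩
  by_cases h2 : ψ = χ
  · subst h2
    exact ⟨φ, Setoid.refl' _ _, h⟩
  have hred : ∀ u v : S, u ≠ v → cs.IsReduced [u, v] := by
    intro u v huv
    refine isReduced_concat (l := [u]) (by simp [CoxeterSystem.IsReduced]) fun hd => ?_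
    rw [cs.wordProd_singleton, cs.isRightDescent_iff, cs.length_simple, Nat.add_eq_right,
      cs.length_eq_zero_iff] at hd
    refine huv (cs.simple_injective hM ?_)
    rw [eq_inv_of_mul_eq_one_left hd, cs.inv_simple]
  have hj : X.Joined φ [t, s] χ := ⟨ψ, ⟨h, h1⟩, χ, ⟨h', h2⟩, rfl⟩
  rw [X.joined_iff _ (hred t s hne.symm)] at hj
  have hj' : X.Joined φ [s, t] χ := by
    rw [X.joined_iff _ (hred s t hne), hj]
    simp [cs.wordProd_cons, cs.simple_mul_comm hst]
  obtain ⟨ρ, h3, h4⟩ := hj'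
  exact ⟨ρ, h3.1, (X.joined_singleton.1 h4).1⟩

theorem isRightDescent_iff_of_equiv {s t : S} (hst : M s t = 2) {φ ψ χ : Φ} (h : X.equiv t ψ χ) :
    cs.IsRightDescent (X.δ φ ψ) s ↔ cs.IsRightDescent (X.δ φ χ) s := by
  rcases δ_eq_or (φ := φ) h with h | h <;> rw [h]
  rw [cs.isRightDescent_mul_simple_iff hM hst]

theorem isRightDescent_iff_of_residue {s : S} {φ ψ χ : Φ}
    (h : X.residue {t | M s t = 2} ψ χ) :
    cs.IsRightDescent (X.δ φ ψ) s ↔ cs.IsRightDescent (X.δ φ χ) s := by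
  rw [X.residue_iff] at h
  induction h with
  | refl => rfl
  | tail _ h ih =>
    obtain ⟨t, ht, h⟩ := h
    rw [ih, isRightDescent_iff_of_equiv hM ht h]

theorem exists_square_residue {s : S} {φ ψ χ : Φ} (h : X.residue {t | M s t = 2} φ ψ)
    (h' : X.equiv s ψ χ) : ∃ ρ, X.equiv s φ ρ ∧ X.residue {t | M s t = 2} ρ χ := by
  rw [X.residue_iff] at h
  induction h generalizing χ with
  | refl => exact ⟨χ, h', Setoid.refl' _ _⟩
  | tail _ h ih =>
    obtain ⟨t, ht, h⟩ := h
    obtain ⟨ρ, h1, h2⟩ := exists_square hM ht h h'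
    obtain ⟨ρ', h3, h4⟩ := ih h1
    exact ⟨ρ', h3, Setoid.trans' _ h4 (X.equiv_le_residue ht h2)⟩

omit hM in
theorem exists_δ_eq_mul {s : S} {φ ψ χ : Φ} (h : X.residue {t | M s t = 2} ψ χ) :
    ∃ l : List S, (∀ t ∈ l, M s t = 2) ∧ X.δ φ χ = X.δ φ ψ * cs.wordProd l := by
  rw [X.residue_iff] at h
  induction h with
  | refl => exact ⟨[], by simp, by simp⟩
  | tail _ h ih =>
    obtain ⟨t, ht, h⟩ := h
    obtain ⟨l, hl, hl'⟩ := ih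
    rcases δ_eq_or (φ := φ) h with h | h
    · exact ⟨l, hl, h.trans hl'⟩
    · refine ⟨l ++ [t], ?_, ?_⟩
      · intro u hu
        rcases List.mem_append.1 hu with hu | hu
        · exact hl u hu
        · rw [List.mem_singleton.1 hu]
          exact ht
      · rw [h, hl', cs.wordProd_append, cs.wordProd_singleton, mul_assoc]

/-- Seen from `φ`, both chambers are nearest in their common `s`-class: moving along types commuting
with `s` does not affect whether `s` is a descent. -/
theorem eq_of_equiv_of_residue {s : S} {φ ψ : Φ} (h : X.equiv s φ ψ)
    (h' : X.residue {t | M s t = 2} φ ψ) : φ = ψ := by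
  have h1 := (isRightDescent_iff_of_residue hM (φ := φ) h').not.1
    (by rw [X.δ_self]; exact cs.not_isRightDescent_one s)
  exact eq_of_not_isRightDescent (φ := φ) h (by rw [X.δ_self]; exact cs.not_isRightDescent_one s) h1

omit hM in
theorem residue_of_isometry {s : S} {f : W → Φ} (hf : ∀ w w', X.δ (f w) (f w') = w⁻¹ * w')
    {l : List S} (hl : ∀ t ∈ l, M s t = 2) (w : W) :
    X.residue {t | M s t = 2} (f w) (f (w * cs.wordProd l)) := by
  induction l generalizing w with
  | nil => simp
  | cons t l ih =>
    have h1 := X.equiv_le_residue (T := {t | M s t = 2}) (hl t List.mem_cons_self)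
      (equiv_of_isometry hf w t)
    refine Setoid.trans' _ h1 ?_
    rw [cs.wordProd_cons, ← mul_assoc]
    exact ih (fun u hu => hl u (List.mem_cons_of_mem _ hu)) _

/-- The setoid of parallelism in direction `s`. -/
def parallelSetoid (X : Building cs Φ) (s : S) : Setoid Φ where
  r := X.Parallel M s
  iseqv :=
    { refl := fun φ => ⟨φ, Setoid.refl' _ _, Setoid.refl' _ _⟩
      symm := by
        rintro φ ψ ⟨χ, h, h'⟩
        obtain ⟨ρ, h1, h2⟩ := exists_square_residue hM (Setoid.symm' _ h') ((X.equiv s).symm h)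
        exact ⟨ρ, h1, h2⟩
      trans := by
        rintro φ ψ χ ⟨ρ, h, h'⟩ ⟨ρ', k, k'⟩
        obtain ⟨σ, h1, h2⟩ := exists_square_residue hM h' k
        exact ⟨σ, Setoid.trans' _ h h1, Setoid.trans' _ h2 k'⟩ }

end RightAngled

end Building

/-! ### Labellings of the chambers -/

theorem Equiv.exists_apply_eq_and_apply_eq {α β : Type*} (e : α ≃ β) {a₀ a₁ : α} {b₀ b₁ : β}
    (ha : a₀ ≠ a₁) (hb : b₀ ≠ b₁) : ∃ e' : α ≃ β, e' a₀ = b₀ ∧ e' a₁ = b₁ := by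
  classical
  let e₁ := e.trans (Equiv.swap (e a₀) b₀)
  have h₀ : e₁ a₀ = b₀ := by simp [e₁]
  refine ⟨e₁.trans (Equiv.swap (e₁ a₁) b₁), ?_, by simp⟩
  rw [Equiv.trans_apply, h₀, Equiv.swap_apply_of_ne_of_ne _ hb]
  rw [← h₀]
  exact e₁.injective.ne ha

namespace Building

variable {S : Type*} {M : CoxeterMatrix S} {W : Type*} [Group W] {cs : CoxeterSystem M W}
  {Φ : Type*}

/-- A labelling of the chambers in direction `s`, based at the chamber `φ₀`: it is a bijection on
every `s`-class, it is constant on the `t`-classes for `t` commuting with `s`, and the chambers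
of label `pt` are the ones at minimal distance from `φ₀` in their `s`-class. -/
structure IsLabelling (X : Building cs Φ) (φ₀ : Φ) (s : S) {Q : Type*} (pt : Q) (κ : Φ → Q) :
    Prop where
  eq_of_commute : ∀ {t φ ψ}, M s t = 2 → X.equiv t φ ψ → κ φ = κ ψ
  eq_of_equiv : ∀ {φ ψ}, X.equiv s φ ψ → κ φ = κ ψ → φ = ψ
  exists_equiv : ∀ φ q, ∃ ψ, X.equiv s φ ψ ∧ κ ψ = q
  eq_base_iff : ∀ φ, κ φ = pt ↔ ¬cs.IsRightDescent (X.δ φ₀ φ) s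

variable {X : Building cs Φ}

theorem injective_of_isometry {f : W → Φ} (hf : ∀ w w', X.δ (f w) (f w') = w⁻¹ * w') :
    Function.Injective f := fun w w' h => by
  have := hf w w'
  rw [h, X.δ_self] at this
  exact eq_of_inv_mul_eq_one this.symm

theorem δ_one_of_isometry {f : W → Φ} (hf : ∀ w w', X.δ (f w) (f w') = w⁻¹ * w') (w : W) :
    X.δ (f 1) (f w) = w := by
  rw [hf, inv_one, one_mul]

/-- Labellings exist, and the labels along a given isometric image of `W` can be prescribed. -/
theorem exists_isLabelling (hM : M.IsRightAngled) {f : W → Φ}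
    (hf : ∀ w w', X.δ (f w) (f w') = w⁻¹ * w') (s : S) {Q : Type*} {pt q₁ : Q} (hne : pt ≠ q₁)
    (hQ : ∀ φ, Nonempty ({χ : Φ // X.equiv s φ χ} ≃ Q)) :
    ∃ κ, X.IsLabelling (f 1) s pt κ ∧ ∀ w, cs.IsRightDescent w s → κ (f w) = q₁ := by
  let E := parallelSetoid hM X s
  have hE : ∀ {φ ψ : Φ}, X.equiv s φ ψ → (Quotient.mk E φ = Quotient.mk E ψ) := fun {φ ψ} h =>
    Quotient.sound ⟨ψ, h, Setoid.refl' _ _⟩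
  have hN : ∀ {φ ψ : Φ}, X.residue {t | M s t = 2} φ ψ → (Quotient.mk E φ = Quotient.mk E ψ) :=
    fun {φ ψ} h => Quotient.sound ⟨φ, Setoid.refl' _ _, h⟩
  -- Each parallel class gets a representative nearest to `f 1` in its `s`-class, chosen in the
  -- image of `f` whenever the class meets that image.
  have hrep : ∀ q : Quotient E, ∃ r, Quotient.mk E r = q ∧
      ¬cs.IsRightDescent (X.δ (f 1) r) s ∧
      ((∃ w, Quotient.mk E (f w) = q) → ∃ v, r = f v) := by
    intro q
    by_cases hq : ∃ w, Quotient.mk E (f w) = q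
    · obtain ⟨w, hw⟩ := hq
      by_cases hd : cs.IsRightDescent w s
      · refine ⟨f (w * cs.simple s), ?_, ?_, fun _ => ⟨_, rfl⟩⟩
        · rw [← hw]
          exact (hE (equiv_of_isometry hf w s)).symm
        · rwa [δ_one_of_isometry hf, ← cs.isRightDescent_iff_not_isRightDescent_mul]
      · exact ⟨f w, hw, by rwa [δ_one_of_isometry hf], fun _ => ⟨_, rfl⟩⟩
    · obtain ⟨φ, rfl⟩ := Quotient.exists_rep q
      obtain ⟨r, hr, hd⟩ := X.exists_not_isRightDescent s (f 1) φ
      exact ⟨r, (hE hr).symm, hd, fun h => absurd h hq⟩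
  choose r hr hrd hrf using hrep
  have hβ : ∀ q, ∃ β : {χ : Φ // X.equiv s (r q) χ} ≃ Q, β ⟨r q, Setoid.refl' _ _⟩ = pt ∧
      ∀ v (h : X.equiv s (r q) (f (v * cs.simple s))), r q = f v → β ⟨_, h⟩ = q₁ := by
    intro q
    obtain ⟨e⟩ := hQ (r q)
    by_cases hv : ∃ v, r q = f v
    · obtain ⟨v, hv⟩ := hv
      have h : X.equiv s (r q) (f (v * cs.simple s)) := by
        rw [hv]
        exact equiv_of_isometry hf v s
      obtain ⟨β, h₀, h₁⟩ := e.exists_apply_eq_and_apply_eq (a₀ := ⟨r q, Setoid.refl' _ _⟩)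
        (a₁ := ⟨_, h⟩) (fun h' => by
          have h2 : r q = f (v * cs.simple s) := congrArg Subtype.val h'
          have h3 := injective_of_isometry hf (hv.symm.trans h2)
          have h4 := cs.length_mul_simple_ne v s
          rw [← h3] at h4
          exact h4 rfl) hne
      refine ⟨β, h₀, fun v' h' hv' => ?_⟩
      obtain rfl := injective_of_isometry hf (hv.symm.trans hv')
      exact h₁
    · obtain ⟨ψ, hψ, hψ'⟩ := X.exists_ne s (r q)
      obtain ⟨β, h₀, -⟩ := e.exists_apply_eq_and_apply_eq (a₀ := ⟨r q, Setoid.refl' _ _⟩)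
        (a₁ := ⟨ψ, hψ⟩) (fun h' => hψ' (congrArg Subtype.val h').symm) hne
      exact ⟨β, h₀, fun v _ h => absurd ⟨v, h⟩ hv⟩
  choose β hβ₀ hβ₁ using hβ
  -- Every chamber is projected, along types commuting with `s`, to the `s`-class of its
  -- representative, and takes its label from there. The projection is unique by
  -- `eq_of_equiv_of_residue`.
  have hp : ∀ φ, ∃ p : {χ : Φ // X.equiv s (r (Quotient.mk E φ)) χ},
      X.residue {t | M s t = 2} p.1 φ := by
    intro φ
    obtain ⟨χ, h, h'⟩ := Quotient.exact (hr (Quotient.mk E φ))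
    exact ⟨⟨χ, h⟩, h'⟩
  choose p hp using hp
  let κ : Φ → Q := fun φ => β _ (p φ)
  have hκ : ∀ {φ q} (χ : {χ : Φ // X.equiv s (r q) χ}), Quotient.mk E φ = q →
      X.residue {t | M s t = 2} χ.1 φ → κ φ = β q χ := by
    rintro φ q χ rfl hχ
    refine congrArg _ (Subtype.ext ?_)
    exact eq_of_equiv_of_residue hM ((X.equiv s).trans ((X.equiv s).symm (p φ).2) χ.2)
      (Setoid.trans' _ (hp φ) (Setoid.symm' _ hχ))
  have hκ' : ∀ φ q, Quotient.mk E φ = q → ∃ χ : {χ : Φ // X.equiv s (r q) χ},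
      X.residue {t | M s t = 2} χ.1 φ ∧ κ φ = β q χ := by
    rintro φ q rfl
    exact ⟨p φ, hp φ, rfl⟩
  refine ⟨κ, ⟨fun {t φ ψ} hst h => ?_, fun {φ ψ} h h' => ?_, fun φ q => ?_, fun φ => ?_⟩,
    fun w hw => ?_⟩
  · have h := X.equiv_le_residue (T := {t | M s t = 2}) hst h
    exact hκ (p ψ) (hN h) (Setoid.trans' _ (hp ψ) (Setoid.symm' _ h))
  · obtain ⟨χ, h1, h2⟩ := hκ' φ _ (hE h)
    have h3 : χ = p ψ := (β _).injective (h2.symm.trans h')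
    rw [h3] at h1
    exact eq_of_equiv_of_residue hM h (Setoid.trans' _ (Setoid.symm' _ h1) (hp ψ))
  · let χ := (β (Quotient.mk E φ)).symm q
    have h1 : Quotient.mk E φ = Quotient.mk E χ.1 := (hr _).symm.trans (hE χ.2)
    obtain ⟨ψ, h2, h3⟩ := Quotient.exact h1
    exact ⟨ψ, h2, (hκ χ (hE h2).symm (Setoid.symm' _ h3)).trans (Equiv.apply_symm_apply _ _)⟩
  · obtain ⟨χ, h1, h2⟩ := hκ' φ _ rfl
    rw [← isRightDescent_iff_of_residue hM h1, h2, ← hβ₀, (β _).injective.eq_iff]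
    constructor
    · rintro rfl
      exact hrd _
    · intro h
      exact Subtype.ext (eq_of_not_isRightDescent χ.2 (hrd _) h).symm
  · obtain ⟨v, hv⟩ := hrf _ ⟨w, rfl⟩
    obtain ⟨χ, h1, h2⟩ := hκ' (f w) _ rfl
    have h3 : X.equiv s (r (Quotient.mk E (f w))) (f (v * cs.simple s)) := by
      rw [hv]
      exact equiv_of_isometry hf v s
    rw [h2, ← hβ₁ _ v h3 hv]
    refine congrArg _ (Subtype.ext ?_)
    -- The projection `χ` of `f w` has to be `f (v * s)`. It is not `f v`, since `s` is a descent at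
    -- `f w` and hence at `χ`; so `w = v * s * l` with all letters of `l` commuting with `s`, and `f
    -- (v * s)` is also a projection of `f w`.
    have h4 : f v ≠ χ.1 := by
      intro h4
      refine (isRightDescent_iff_of_residue hM (φ := f 1) h1).not.1 ?_
        (by rwa [δ_one_of_isometry hf])
      rw [← h4, ← hv]
      exact hrd _
    have h5 : X.equiv s (f v) χ.1 := (X.equiv s).trans (hv ▸ Setoid.refl' _ _) χ.2
    obtain ⟨l, hl, hl'⟩ := exists_δ_eq_mul (φ := f v) h1
    rw [hf, δ_eq_simple h5 h4, inv_mul_eq_iff_eq_mul, ← mul_assoc] at hl'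
    have h6 := residue_of_isometry hf hl (v * cs.simple s)
    rw [← hl'] at h6
    exact eq_of_equiv_of_residue hM
      ((X.equiv s).trans ((X.equiv s).symm h5) (equiv_of_isometry hf v s))
      (Setoid.trans' _ h1 (Setoid.symm' _ h6))

end Building

/-! ### Extending a pair of apartments to an automorphism -/

namespace Building

variable {S : Type*} {M : CoxeterMatrix S} {W : Type*} [Group W] {cs : CoxeterSystem M W}
  {Φ : Type*}

/-- The correspondence between the chambers which are reached from `φ₀` and from `φ₀'` along
galleries of minimal length having the same types and the same labels. -/
inductive Corresponds (X : Building cs Φ) {Q : S → Type*} (φ₀ φ₀' : Φ) (κ κ' : ∀ s, Φ → Q s) :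
    Φ → Φ → Prop
  | base : Corresponds X φ₀ φ₀' κ κ' φ₀ φ₀'
  | step {φ φ' ψ ψ' : Φ} (s : S) (h : Corresponds X φ₀ φ₀' κ κ' φ φ') (hψ : X.equiv s φ ψ)
      (hψ' : X.equiv s φ' ψ') (hφ : ¬cs.IsRightDescent (X.δ φ₀ φ) s) (hne : φ ≠ ψ)
      (hκ : κ s ψ = κ' s ψ') : Corresponds X φ₀ φ₀' κ κ' ψ ψ'

variable {X : Building cs Φ} {Q : S → Type*} {pt : ∀ s, Q s} {φ₀ φ₀' : Φ} {κ κ' : ∀ s, Φ → Q s}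

namespace Corresponds

/-- The label `pt s` marks nearest chambers on both sides, so a step away from a nearest chamber
cannot correspond to a stationary one. -/
theorem ne_of_eq (hκ : ∀ s, X.IsLabelling φ₀ s (pt s) (κ s))
    (hκ' : ∀ s, X.IsLabelling φ₀' s (pt s) (κ' s)) {φ φ' ψ ψ' : Φ} {s : S}
    (hd : X.δ φ₀ φ = X.δ φ₀' φ') (hψ : X.equiv s φ ψ)
    (hφ : ¬cs.IsRightDescent (X.δ φ₀ φ) s) (hne : φ ≠ ψ) (h : κ s ψ = κ' s ψ') : φ' ≠ ψ' := by
  rintro rfl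
  have hψs := isRightDescent_of_not_isRightDescent hψ hne hφ
  rw [hd, ← (hκ' s).eq_base_iff, ← h, (hκ s).eq_base_iff] at hφ
  exact hφ hψs

theorem δ_eq (hκ : ∀ s, X.IsLabelling φ₀ s (pt s) (κ s))
    (hκ' : ∀ s, X.IsLabelling φ₀' s (pt s) (κ' s)) {φ φ' : Φ}
    (h : X.Corresponds φ₀ φ₀' κ κ' φ φ') : X.δ φ₀ φ = X.δ φ₀' φ' := by
  induction h with
  | base => rw [X.δ_self, X.δ_self]
  | step s _ hψ hψ' hφ hne h ih =>
    rw [δ_eq_mul_of_not_isRightDescent hψ hne hφ,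
      δ_eq_mul_of_not_isRightDescent hψ' (ne_of_eq hκ hκ' ih hψ hφ hne h) (by rwa [← ih]), ih]

theorem symm (hκ : ∀ s, X.IsLabelling φ₀ s (pt s) (κ s))
    (hκ' : ∀ s, X.IsLabelling φ₀' s (pt s) (κ' s)) {φ φ' : Φ}
    (h : X.Corresponds φ₀ φ₀' κ κ' φ φ') : X.Corresponds φ₀' φ₀ κ' κ φ' φ := by
  induction h with
  | base => exact base
  | step s h hψ hψ' hφ hne h' ih =>
    have hd := h.δ_eq hκ hκ'
    exact step s ih hψ' hψ (by rwa [← hd]) (ne_of_eq hκ hκ' hd hψ hφ hne h') h'.symm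

/-- Corresponding chambers can be completed along `s`-classes. -/
theorem of_equiv (hκ : ∀ s, X.IsLabelling φ₀ s (pt s) (κ s))
    (hκ' : ∀ s, X.IsLabelling φ₀' s (pt s) (κ' s)) {φ φ' ψ ψ' : Φ} {s : S}
    (h : X.Corresponds φ₀ φ₀' κ κ' φ φ') (hφ : ¬cs.IsRightDescent (X.δ φ₀ φ) s)
    (hψ : X.equiv s φ ψ) (hψ' : X.equiv s φ' ψ') (hl : κ s ψ = κ' s ψ') :
    X.Corresponds φ₀ φ₀' κ κ' ψ ψ' := by
  by_cases hne : φ = ψ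
  · subst hne
    have : φ' = ψ' := by
      refine (hκ' s).eq_of_equiv hψ' ?_
      rw [← hl, (hκ s).eq_base_iff _ |>.2 hφ, (hκ' s).eq_base_iff, ← h.δ_eq hκ hκ']
      exact hφ
    rwa [← this]
  · exact step s h hψ hψ' hφ hne hl

theorem exists_right (κ : ∀ s, Φ → Q s) (hκ' : ∀ s, X.IsLabelling φ₀' s (pt s) (κ' s)) (φ : Φ) :
    ∃ φ', X.Corresponds φ₀ φ₀' κ κ' φ φ' := by
  induction hn : cs.length (X.δ φ₀ φ) using Nat.strong_induction_on generalizing φ with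
  | _ n ih =>
    by_cases h1 : X.δ φ₀ φ = 1
    · rw [X.δ_eq_one_iff] at h1
      subst h1
      exact ⟨φ₀', base⟩
    · obtain ⟨s, hs⟩ := cs.exists_rightDescent_of_ne_one h1
      obtain ⟨ψ, hψ, hψs⟩ := X.exists_not_isRightDescent s φ₀ φ
      have hψ1 := (X.equiv s).symm hψ
      have hne : ψ ≠ φ := by
        rintro rfl
        exact hψs hs
      have h2 := δ_eq_mul_of_not_isRightDescent hψ1 hne hψs
      have h3 := cs.not_isRightDescent_iff.1 hψs
      rw [← h2] at h3
      obtain ⟨ψ', hψ'⟩ := ih (cs.length (X.δ φ₀ ψ)) (by omega) ψ rfl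
      obtain ⟨φ', h4, h5⟩ := (hκ' s).exists_equiv ψ' (κ s φ)
      exact ⟨φ', step s hψ' hψ1 h4 hψs hne h5.symm⟩

/-- Induction on the distance from `φ₀`, comparing last steps. Equal types give equal predecessors
and then equal labels; distinct types commute and are compared through a square. -/
theorem unique_right (hM : M.IsRightAngled) (hκ : ∀ s, X.IsLabelling φ₀ s (pt s) (κ s))
    (hκ' : ∀ s, X.IsLabelling φ₀' s (pt s) (κ' s)) {φ φ₁ φ₂ : Φ}
    (h₁ : X.Corresponds φ₀ φ₀' κ κ' φ φ₁) (h₂ : X.Corresponds φ₀ φ₀' κ κ' φ φ₂) : φ₁ = φ₂ := by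
  induction hn : cs.length (X.δ φ₀ φ) using Nat.strong_induction_on generalizing φ φ₁ φ₂ with
  | _ n ih =>
    have hlt : ∀ {ψ χ : Φ} {s : S}, X.equiv s ψ χ → ¬cs.IsRightDescent (X.δ φ₀ ψ) s → ψ ≠ χ →
        cs.length (X.δ φ₀ ψ) < cs.length (X.δ φ₀ χ) := by
      intro ψ χ s h hs hne
      rw [δ_eq_mul_of_not_isRightDescent h hne hs, cs.not_isRightDescent_iff.1 hs]
      omega
    have hbase : ∀ {ψ : Φ} {s : S}, X.equiv s ψ φ₀ → ¬cs.IsRightDescent (X.δ φ₀ ψ) s →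
        ψ = φ₀ := fun h hs => eq_of_not_isRightDescent h hs
          (by rw [X.δ_self]; exact cs.not_isRightDescent_one _)
    cases h₁ with
    | base =>
      cases h₂ with
      | base => rfl
      | step s h hψ hψ' hφ hne hl => exact absurd (hbase hψ hφ) hne
    | @step ψ₁ ψ₁' _ _ s k₁ e₁ e₁' d₁ n₁ l₁ =>
      cases h₂ with
      | base => exact absurd (hbase e₁ d₁) n₁
      | @step ψ₂ ψ₂' _ _ t k₂ e₂ e₂' d₂ n₂ l₂ =>
        by_cases hst : s = t
        · subst hst
          obtain rfl := eq_of_not_isRightDescent ((X.equiv s).trans e₁ ((X.equiv s).symm e₂)) d₁ d₂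
          obtain rfl := ih _ (by rw [← hn]; exact hlt e₁ d₁ n₁) k₁ k₂ rfl
          exact (hκ' s).eq_of_equiv ((X.equiv s).trans ((X.equiv s).symm e₁') e₂')
            (l₁.symm.trans l₂)
        · have hs := isRightDescent_of_not_isRightDescent e₁ n₁ d₁
          have ht := isRightDescent_of_not_isRightDescent e₂ n₂ d₂
          have hm : M s t = 2 := cs.eq_two_of_isRightDescent hM hst hs ht
          have hm' : M t s = 2 := by rw [M.symmetric]; exact hm
          -- The square has corners `χ`, `ψ₁`, `φ`, `ψ₂`, with `χ` nearest to `φ₀`. By induction a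
          -- partner `χ'` is joined to `ψ₁'` and `ψ₂'`; the fourth corner `τ` of the square on these
          -- has the labels of both `φ₁` and `φ₂`.
          obtain ⟨χ, hχ, hχd⟩ := X.exists_not_isRightDescent t φ₀ ψ₁
          have hχ1 := (X.equiv t).symm hχ
          have hψ₁ : cs.IsRightDescent (X.δ φ₀ ψ₁) t :=
            (isRightDescent_iff_of_equiv hM hm' e₁).2 ht
          have hχne : χ ≠ ψ₁ := by
            rintro rfl
            exact hχd hψ₁
          obtain ⟨ρ, hρ, hρ'⟩ := exists_square hM hm hχ1 e₁
          obtain rfl : ρ = ψ₂ := by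
            refine eq_of_not_isRightDescent ((X.equiv t).trans hρ' ((X.equiv t).symm e₂)) ?_ d₂
            rwa [← isRightDescent_iff_of_equiv hM hm' hρ]
          have hχs : ¬cs.IsRightDescent (X.δ φ₀ χ) s := by
            rwa [isRightDescent_iff_of_equiv hM hm hχ1]
          have hl1 := hlt e₁ d₁ n₁
          have hl2 := hlt e₂ d₂ n₂
          obtain ⟨χ', hχ'⟩ := exists_right κ hκ' χ
          obtain ⟨σ₁, a₁, b₁⟩ := (hκ' t).exists_equiv χ' (κ t ψ₁)
          obtain rfl := ih _ (by omega) (of_equiv hκ hκ' hχ' hχd hχ1 a₁ b₁.symm) k₁ rfl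
          obtain ⟨σ₂, a₂, b₂⟩ := (hκ' s).exists_equiv χ' (κ s ρ)
          obtain rfl := ih _ (by omega) (of_equiv hκ hκ' hχ' hχs hρ a₂ b₂.symm) k₂ rfl
          obtain ⟨τ, c₁, c₂⟩ := exists_square hM hm ((X.equiv t).symm a₁) a₂
          have hτ₁ : φ₁ = τ := by
            refine (hκ' s).eq_of_equiv ((X.equiv s).trans ((X.equiv s).symm e₁') c₁) ?_
            rw [(hκ' s).eq_of_commute hm c₂, b₂, ← l₁, (hκ s).eq_of_commute hm e₂]
          have hτ₂ : φ₂ = τ := by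
            refine (hκ' t).eq_of_equiv ((X.equiv t).trans ((X.equiv t).symm e₂')
              ((X.equiv t).symm c₂)) ?_
            rw [← (hκ' t).eq_of_commute hm' c₁, b₁, ← l₂, (hκ t).eq_of_commute hm' e₁]
          rw [hτ₁, hτ₂]

/-- Both partners are `s`-equivalent to a partner of the nearest chamber `χ` of the class. -/
theorem equiv_map (hM : M.IsRightAngled) (hκ : ∀ s, X.IsLabelling φ₀ s (pt s) (κ s))
    (hκ' : ∀ s, X.IsLabelling φ₀' s (pt s) (κ' s)) {s : S} {φ φ' ψ ψ' : Φ}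
    (h₁ : X.Corresponds φ₀ φ₀' κ κ' φ φ') (h₂ : X.Corresponds φ₀ φ₀' κ κ' ψ ψ')
    (h : X.equiv s φ ψ) : X.equiv s φ' ψ' := by
  obtain ⟨χ, hχ, hχs⟩ := X.exists_not_isRightDescent s φ₀ φ
  obtain ⟨χ', hχ'⟩ := exists_right κ hκ' χ
  have key : ∀ {φ φ' : Φ}, X.Corresponds φ₀ φ₀' κ κ' φ φ' → X.equiv s χ φ → X.equiv s χ' φ' := by
    intro φ φ' h₁ h
    obtain ⟨σ, a, b⟩ := (hκ' s).exists_equiv χ' (κ s φ)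
    rwa [← unique_right hM hκ hκ' (of_equiv hκ hκ' hχ' hχs h a b.symm) h₁]
  exact (X.equiv s).trans ((X.equiv s).symm (key h₁ ((X.equiv s).symm hχ)))
    (key h₂ ((X.equiv s).trans ((X.equiv s).symm hχ) h))

end Corresponds

/-- Any two isometric images of `W` in a regular right-angled building are related by an
automorphism of the underlying chamber system. -/
theorem exists_perm_comp_eq (hM : M.IsRightAngled) (hX : X.IsRegular) {f f' : W → Φ}
    (hf : ∀ w w', X.δ (f w) (f w') = w⁻¹ * w') (hf' : ∀ w w', X.δ (f' w) (f' w') = w⁻¹ * w') :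
    ∃ g : Equiv.Perm Φ, (∀ s φ ψ, X.equiv s (g φ) (g ψ) ↔ X.equiv s φ ψ) ∧ ∀ w, g (f w) = f' w := by
  -- The `s`-class of `f 1` serves as the label set for both labellings; `q₁` is any label other
  -- than the base label.
  let Q : S → Type _ := fun s => {χ : Φ // X.equiv s (f 1) χ}
  let pt : ∀ s, Q s := fun s => ⟨f 1, Setoid.refl' _ _⟩
  have hQ : ∀ s φ, Nonempty ({χ : Φ // X.equiv s φ χ} ≃ Q s) := fun s φ =>
    Cardinal.eq.1 (hX s φ (f 1))
  choose ψ hψ hψ' using fun s => X.exists_ne s (f 1)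
  let q₁ : ∀ s, Q s := fun s => ⟨ψ s, hψ s⟩
  have hne : ∀ s, pt s ≠ q₁ s := fun s h => hψ' s (congrArg Subtype.val h).symm
  choose κ hκ hκ₁ using fun s => exists_isLabelling hM hf s (hne s) (hQ s)
  choose κ' hκ' hκ₁' using fun s => exists_isLabelling hM hf' s (hne s) (hQ s)
  choose g hg using Corresponds.exists_right κ hκ'
  choose g' hg' using Corresponds.exists_right κ' hκ
  have hgg' : ∀ φ, g' (g φ) = φ := fun φ =>
    Corresponds.unique_right hM hκ' hκ (hg' (g φ)) ((hg φ).symm hκ hκ')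
  have hg'g : ∀ φ, g (g' φ) = φ := fun φ =>
    Corresponds.unique_right hM hκ hκ' (hg (g' φ)) ((hg' φ).symm hκ' hκ)
  refine ⟨⟨g, g', hgg', hg'g⟩, fun s φ ψ => ⟨fun h => ?_, fun h => ?_⟩, fun w => ?_⟩
  · exact Corresponds.equiv_map hM hκ' hκ ((hg φ).symm hκ hκ') ((hg ψ).symm hκ hκ') h
  · exact Corresponds.equiv_map hM hκ hκ' (hg φ) (hg ψ) h
  · refine Corresponds.unique_right hM hκ hκ' (hg (f w)) ?_
    -- Removing a right descent `s` of `w` leads to nearest chambers in both apartments, and the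
    -- step back has label `q₁ s` in both.
    induction hn : cs.length w using Nat.strong_induction_on generalizing w with
    | _ n ih =>
      by_cases h1 : w = 1
      · rw [h1]
        exact .base
      · obtain ⟨s, hs⟩ := cs.exists_rightDescent_of_ne_one h1
        have hs' := cs.isRightDescent_iff_not_isRightDescent_mul.1 hs
        have he := ih _ (hn ▸ hs) (w * cs.simple s) rfl
        refine Corresponds.of_equiv hκ hκ' he (by rwa [δ_one_of_isometry hf])
          ((X.equiv s).symm (equiv_of_isometry hf w s))
          ((X.equiv s).symm (equiv_of_isometry hf' w s)) ?_
        rw [hκ₁ s w hs, hκ₁' s w hs]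

end Building

/-! ### Vertices and mirrors of the model chamber -/

namespace CoxeterSystem

variable {S : Type*} {M : CoxeterMatrix S} {W : Type*} [Group W]

theorem isSpherical_singleton (cs : CoxeterSystem M W) (s : S) : cs.IsSpherical {s} := by
  unfold IsSpherical
  rw [Set.image_singleton, ← Subgroup.zpowers_eq_closure]
  exact Set.Finite.to_subtype (finite_zpowers.2
    (isOfFinOrder_iff_pow_eq_one.2 ⟨2, two_pos, cs.simple_sq s⟩))

/-- The spherical subset `{s}`. -/
def singletonSpherical (cs : CoxeterSystem M W) (s : S) : cs.Spherical :=
  ⟨{s}, cs.isSpherical_singleton s⟩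

theorem emptySpherical_le (cs : CoxeterSystem M W) (T : cs.Spherical) : cs.emptySpherical ≤ T :=
  Set.empty_subset T.1

namespace ModelChamber

variable {cs : CoxeterSystem M W}

theorem vertex_mem_simplex {T : cs.Spherical} {c : Set cs.Spherical} :
    vertex T ∈ simplex c ↔ T ∈ c := by
  change (((Finsupp.single T (1 : ℝ)).support : Set cs.Spherical) ⊆ c) ↔ T ∈ c
  rw [Finsupp.support_single _ one_ne_zero, Finset.coe_singleton, Set.singleton_subset_iff]

/-- A chain through `{s}` and `T` that avoids `∅` forces `s ∈ T`. Thus centers lie in no mirror, and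
a vertex of type `{s}` only in the `s`-mirror. -/
theorem mirrorTypes_vertex (T : cs.Spherical) : (vertex T).mirrorTypes = T.1 := by
  ext s
  constructor
  · rintro ⟨c, hc, ⟨U, hU, hUs⟩, h0, hT⟩
    rw [vertex_mem_simplex] at hT
    rcases hc.total hU hT with h | h
    · exact h (by rw [hUs]; rfl)
    · have h : T.1 ⊆ {s} := hUs ▸ h
      rcases Set.subset_singleton_iff_eq.1 h with h | h
      · exact absurd ((Subtype.ext h : T = cs.emptySpherical) ▸ hT) h0
      · rw [h]
        rfl
  · intro hs
    refine ⟨{cs.singletonSpherical s, T}, ?_, ⟨_, Set.mem_insert _ _, rfl⟩, ?_, ?_⟩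
    · exact IsChain.pair (Set.singleton_subset_iff.2 hs : ({s} : Set S) ⊆ T.1)
    · rintro (h | h)
      · have : s ∈ cs.emptySpherical.1 := by
          rw [h]
          rfl
        exact this
      · rw [← show cs.emptySpherical = T from h] at hs
        exact hs
    · rw [vertex_mem_simplex]
      exact Or.inr rfl

end ModelChamber

end CoxeterSystem

/-! ### Chamber automorphisms and type-preserving isometries -/

namespace Building

open CoxeterSystem.ModelChamber

variable {S : Type*} {M : CoxeterMatrix S} {W : Type*} [Group W] {cs : CoxeterSystem M W}
  {Φ : Type*} (X : Building cs Φ)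

theorem point_eq_point_iff {φ ψ : Φ} {x y : cs.ModelChamber} :
    X.point φ x = X.point ψ y ↔ x = y ∧ X.residue x.mirrorTypes φ ψ :=
  Quotient.eq (r := X.gluing)

theorem eq_of_center_eq_point {φ ψ : Φ} {x : cs.ModelChamber} (h : X.center φ = X.point ψ x) :
    φ = ψ := by
  have := (X.point_eq_point_iff.1 h).2
  rw [mirrorTypes_vertex] at this
  change X.residue ∅ φ ψ at this
  rwa [X.residue_empty] at this

theorem center_injective : Function.Injective X.center := fun _ _ h => X.eq_of_center_eq_point h

theorem center_mem_chamber (φ : Φ) : X.center φ ∈ X.chamber φ := ⟨_, rfl⟩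

/-- This recovers the chamber system from data preserved by type-preserving maps that permute the
chambers. -/
theorem equiv_iff_exists_vertex {s : S} {φ ψ : Φ} :
    X.equiv s φ ψ ↔ ∃ p, X.IsVertexOfType p (cs.singletonSpherical s) ∧
      p ∈ X.chamber φ ∧ p ∈ X.chamber ψ := by
  have key : ∀ {χ ρ}, X.point χ (vertex (cs.singletonSpherical s)) ∈ X.chamber ρ ↔
      X.equiv s χ ρ := by
    intro χ ρ
    rw [← X.residue_singleton]
    constructor
    · rintro ⟨x, hx⟩
      have := (X.point_eq_point_iff.1 hx.symm).2
      rwa [mirrorTypes_vertex] at this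
    · intro h
      refine ⟨vertex (cs.singletonSpherical s), (X.point_eq_point_iff.2 ⟨rfl, ?_⟩).symm⟩
      rwa [mirrorTypes_vertex]
  constructor
  · intro h
    exact ⟨_, ⟨φ, rfl⟩, key.2 (Setoid.refl' _ _), key.2 h⟩
  · rintro ⟨_, ⟨χ, rfl⟩, h, h'⟩
    exact (X.equiv s).trans ((X.equiv s).symm (key.1 h)) (key.1 h')

/-- The permutation of the geometric realization induced by an automorphism of the underlying
chamber system. -/
def realizationPerm (g : Equiv.Perm Φ) (hg : ∀ s φ ψ, X.equiv s (g φ) (g ψ) ↔ X.equiv s φ ψ) :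
    Equiv.Perm X.Realization :=
  Quotient.congr (g.prodCongr (Equiv.refl _)) fun _ _ =>
    and_congr_right fun _ => (X.residue_map_iff g hg).symm

section realizationPerm

variable {X} {g : Equiv.Perm Φ} (hg : ∀ s φ ψ, X.equiv s (g φ) (g ψ) ↔ X.equiv s φ ψ)

theorem realizationPerm_point (φ : Φ) (x : cs.ModelChamber) :
    X.realizationPerm g hg (X.point φ x) = X.point (g φ) x := rfl

theorem toModel_realizationPerm (p : X.Realization) :
    X.toModel (X.realizationPerm g hg p) = X.toModel p := by
  induction p using Quotient.inductionOn
  rfl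

theorem realizationPerm_smul_image (φ : Φ) (A : Set cs.ModelChamber) :
    X.realizationPerm g hg • (X.point φ '' A) = X.point (g φ) '' A := by
  rw [← Set.image_smul, Set.image_image]
  rfl

theorem realizationPerm_smul_chamber (φ : Φ) :
    X.realizationPerm g hg • X.chamber φ = X.chamber (g φ) := by
  rw [chamber, ← Set.image_univ, realizationPerm_smul_image, Set.image_univ, chamber]

theorem isSimplex_realizationPerm_smul (σ : Set X.Realization) :
    X.IsSimplex (X.realizationPerm g hg • σ) ↔ X.IsSimplex σ := by
  constructor
  · rintro ⟨φ, c, hc, hc', h⟩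
    refine ⟨g.symm φ, c, hc, hc', ?_⟩
    rw [← smul_left_cancel_iff (X.realizationPerm g hg), h, realizationPerm_smul_image,
      Equiv.apply_symm_apply]
  · rintro ⟨φ, c, hc, hc', rfl⟩
    exact ⟨g φ, c, hc, hc', realizationPerm_smul_image hg _ _⟩

theorem isVertexOfType_realizationPerm (p : X.Realization) (T : cs.Spherical) :
    X.IsVertexOfType (X.realizationPerm g hg p) T ↔ X.IsVertexOfType p T := by
  constructor
  · rintro ⟨φ, h⟩
    refine ⟨g.symm φ, (X.realizationPerm g hg).injective ?_⟩
    rw [h, realizationPerm_point, Equiv.apply_symm_apply]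
  · rintro ⟨φ, rfl⟩
    exact ⟨g φ, rfl⟩

/-- Strings of points go to strings of the same length, as lengths depend only on the images in the
model chamber. -/
theorem lengthDist_le_of_perm [Fintype S] (ℓ : S → ℝ) (h : Equiv.Perm X.Realization)
    (hσ : ∀ σ, X.IsSimplex σ → X.IsSimplex (h • σ)) (hK : ∀ p, X.toModel (h p) = X.toModel p)
    (p q : X.Realization) : X.lengthDist ℓ (h p) (h q) ≤ X.lengthDist ℓ p q := by
  refine le_iInf fun n => le_iInf fun x => le_iInf fun h0 => le_iInf fun hn => le_iInf fun hx => ?_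
  refine iInf_le_of_le n (iInf_le_of_le (fun i => h (x i)) (iInf_le_of_le (congrArg h h0)
    (iInf_le_of_le (congrArg h hn) (iInf_le_of_le (fun i hi => ?_) ?_))))
  · obtain ⟨σ, h1, h2, h3⟩ := hx i hi
    exact ⟨h • σ, hσ σ h1, Set.smul_mem_smul_set h2, Set.smul_mem_smul_set h3⟩
  · simp only [hK]
    exact le_rfl

theorem realizationPerm_mem_aut₀ [Fintype S] (ℓ : S → ℝ) : X.realizationPerm g hg ∈ X.aut₀ ℓ := by
  refine ⟨⟨fun p q => le_antisymm ?_ ?_, isSimplex_realizationPerm_smul hg⟩,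
    isVertexOfType_realizationPerm hg⟩
  · exact lengthDist_le_of_perm ℓ _ (fun σ => (isSimplex_realizationPerm_smul hg σ).2)
      (toModel_realizationPerm hg) p q
  · have := lengthDist_le_of_perm ℓ (X.realizationPerm g hg)⁻¹
      (fun σ h => by
        rwa [← isSimplex_realizationPerm_smul hg, smul_inv_smul])
      (fun p => by
        rw [← toModel_realizationPerm hg]
        simp) (X.realizationPerm g hg p) (X.realizationPerm g hg q)
    simpa using this

end realizationPerm

variable {X}

/-- Each point of a chamber shares a closed simplex with the center, as `∅` can be added to any
chain. The image simplex contains the center of `ψ`, which lies in no other chamber. -/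
theorem smul_chamber_subset [Fintype S] {ℓ : S → ℝ} {h : Equiv.Perm X.Realization}
    (hh : h ∈ X.aut ℓ) {φ ψ : Φ} (hφ : h (X.center φ) = X.center ψ) :
    h • X.chamber φ ⊆ X.chamber ψ := by
  rw [← Set.image_smul]
  rintro _ ⟨_, ⟨x, rfl⟩, rfl⟩
  let c : Set cs.Spherical := insert cs.emptySpherical x.1.support
  have hc : X.IsSimplex (X.point φ '' simplex c) := ⟨φ, c, Set.insert_nonempty _ _,
    x.2.2.1.insert fun T _ _ => Or.inl (cs.emptySpherical_le T), rfl⟩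
  obtain ⟨χ, c', -, -, h'⟩ := (hh.2 _).2 hc
  have h1 : X.center ψ ∈ h • (X.point φ '' simplex c) := by
    rw [← hφ]
    exact Set.smul_mem_smul_set ⟨_, vertex_mem_simplex.2 (Set.mem_insert _ _), rfl⟩
  have h2 : h • X.point φ x ∈ h • (X.point φ '' simplex c) :=
    Set.smul_mem_smul_set ⟨x, Set.subset_insert _ _, rfl⟩
  rw [h'] at h1 h2
  obtain ⟨y, -, hy⟩ := h1
  obtain ⟨z, -, hz⟩ := h2
  rw [X.eq_of_center_eq_point hy.symm]
  exact ⟨z, hz⟩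

/-- A type-preserving cellular isometry of the geometric realization induces an automorphism of
the underlying chamber system. -/
theorem exists_perm_of_mem_aut₀ [Fintype S] {ℓ : S → ℝ} {h : Equiv.Perm X.Realization}
    (hh : h ∈ X.aut₀ ℓ) : ∃ g : Equiv.Perm Φ,
      (∀ s φ ψ, X.equiv s (g φ) (g ψ) ↔ X.equiv s φ ψ) ∧
      (∀ φ, h (X.center φ) = X.center (g φ)) ∧ ∀ φ, h • X.chamber φ = X.chamber (g φ) := by
  have key : ∀ k ∈ X.aut₀ ℓ, ∀ φ, ∃ ψ, k (X.center φ) = X.center ψ := fun k hk φ =>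
    (hk.2 _ cs.emptySpherical).2 ⟨φ, rfl⟩
  choose g hg using key h hh
  choose g' hg' using key h⁻¹ (inv_mem hh)
  have h1 : ∀ φ, g' (g φ) = φ := fun φ => X.center_injective <| by
    rw [← hg', ← hg]
    simp
  have h2 : ∀ φ, g (g' φ) = φ := fun φ => X.center_injective <| by
    rw [← hg, ← hg']
    simp
  have h3 : ∀ φ, h • X.chamber φ = X.chamber (g φ) := by
    intro φ
    refine (smul_chamber_subset hh.1 (hg φ)).antisymm ?_
    rw [Set.subset_smul_set_iff]
    refine smul_chamber_subset (inv_mem hh).1 ?_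
    rw [hg', h1]
  refine ⟨⟨g, g', h1, h2⟩, fun s φ ψ => ?_, hg, h3⟩
  rw [equiv_iff_exists_vertex, equiv_iff_exists_vertex, h.surjective.exists]
  refine exists_congr fun p => and_congr (hh.2 _ _) (and_congr ?_ ?_)
  · rw [Equiv.coe_fn_mk, ← h3]
    exact Set.smul_mem_smul_set_iff
  · rw [Equiv.coe_fn_mk, ← h3]
    exact Set.smul_mem_smul_set_iff

theorem smul_mem_apartments [Fintype S] {ℓ : S → ℝ} {h : Equiv.Perm X.Realization}
    (hh : h ∈ X.aut₀ ℓ) {A : Set X.Realization} (hA : A ∈ X.apartments) :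
    h • A ∈ X.apartments := by
  obtain ⟨g, hg, -, hgc⟩ := exists_perm_of_mem_aut₀ hh
  obtain ⟨f, hf, rfl⟩ := hA
  refine ⟨fun w => g (f w), fun w w' => by rw [X.δ_map g hg, hf], ?_⟩
  rw [Set.smul_set_iUnion]
  simp only [hgc]

/-- An apartment containing a chamber is the image of a `W`-isometry based at that chamber. -/
theorem exists_isometry_of_chamber_subset {A : Set X.Realization} (hA : A ∈ X.apartments) {φ : Φ}
    (hφ : X.chamber φ ⊆ A) : ∃ f : W → Φ, (∀ w w', X.δ (f w) (f w') = w⁻¹ * w') ∧ f 1 = φ ∧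
      A = ⋃ w, X.chamber (f w) := by
  obtain ⟨f, hf, rfl⟩ := hA
  obtain ⟨v, x, hx⟩ := Set.mem_iUnion.1 (hφ (X.center_mem_chamber φ))
  obtain rfl := X.eq_of_center_eq_point hx.symm
  -- Left translation preserves the `W`-distance on `W`, so the base point can be moved to `v`.
  refine ⟨fun w => f (v * w), fun w w' => by rw [hf]; group, by simp, ?_⟩
  exact ((Equiv.mulLeft v).iSup_comp (g := fun w => X.chamber (f w))).symm

/-- Type-preserving automorphisms act transitively on apartments with a marked chamber. -/
theorem exists_mem_aut₀ [Fintype S] (hM : M.IsRightAngled) (hX : X.IsRegular) (ℓ : S → ℝ)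
    {A A' : Set X.Realization} (hA : A ∈ X.apartments) (hA' : A' ∈ X.apartments) {φ φ' : Φ}
    (hφ : X.chamber φ ⊆ A) (hφ' : X.chamber φ' ⊆ A') :
    ∃ h ∈ X.aut₀ ℓ, h (X.center φ) = X.center φ' ∧ h • X.chamber φ = X.chamber φ' ∧
      h • A = A' := by
  obtain ⟨f, hf, rfl, rfl⟩ := exists_isometry_of_chamber_subset hA hφ
  obtain ⟨f', hf', rfl, rfl⟩ := exists_isometry_of_chamber_subset hA' hφ'
  obtain ⟨g, hg, hgf⟩ := exists_perm_comp_eq hM hX hf hf'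
  refine ⟨X.realizationPerm g hg, realizationPerm_mem_aut₀ hg ℓ, ?_, ?_, ?_⟩
  · rw [center, realizationPerm_point, hgf, center]
  · rw [realizationPerm_smul_chamber, hgf]
  · rw [Set.smul_set_iUnion]
    simp only [realizationPerm_smul_chamber, hgf]

end Building

end

/-! ### Transitivity on apartments and on flags -/

theorem theoremt {S : Type*} [Fintype S] {M : CoxeterMatrix S} (hM : M.IsRightAngled)
    {W : Type*} [Group W] (cs : CoxeterSystem M W) {Φ : Type*} (X : Building cs Φ)
    (hX : X.IsRegular) (ℓ : S → ℝ) (hℓ : ∀ s, 0 < ℓ s) :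
    (∀ φ : Φ,
      (X.aut₀ ℓ ⊓ MulAction.stabilizer (Equiv.Perm X.Realization) (X.center φ)).ActsTransitivelyOn
        {A : Set X.Realization | A ∈ X.apartments ∧ X.chamber φ ⊆ A}) ∧
    (X.aut₀ ℓ).ActsTransitivelyOn X.flags ∧
    (X.aut ℓ).TransitiveOn X.flags := by
  have htrans : (X.aut₀ ℓ).TransitiveOn X.flags := by
    rintro ⟨_, A⟩ ⟨⟨φ, rfl⟩, hA, hφ⟩ ⟨_, A'⟩ ⟨⟨φ', rfl⟩, hA', hφ'⟩
    obtain ⟨h, hh, -, h1, h2⟩ := Building.exists_mem_aut₀ hM hX ℓ hA hA' hφ hφ'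
    exact ⟨h, hh, Prod.ext h1 h2⟩
  refine ⟨fun φ => ⟨?_, ?_⟩, ⟨?_, htrans⟩, fun a ha b hb => ?_⟩
  · rintro h ⟨hh, hc⟩ A ⟨hA, hφ⟩
    refine ⟨Building.smul_mem_apartments hh hA, ?_⟩
    obtain ⟨g, -, hg, hg'⟩ := Building.exists_perm_of_mem_aut₀ hh
    have h1 : g φ = φ := X.center_injective ((hg φ).symm.trans hc)
    have h2 := hg' φ
    rw [h1] at h2
    rw [← h2]
    exact Set.smul_set_mono hφ
  · rintro A ⟨hA, hφ⟩ A' ⟨hA', hφ'⟩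
    obtain ⟨h, hh, h0, -, h2⟩ := Building.exists_mem_aut₀ hM hX ℓ hA hA' hφ hφ'
    exact ⟨h, ⟨hh, h0⟩, h2⟩
  · rintro h hh ⟨_, A⟩ ⟨⟨φ, rfl⟩, hA, hφ⟩
    obtain ⟨g, -, -, hg⟩ := Building.exists_perm_of_mem_aut₀ hh
    exact ⟨⟨g φ, (hg φ).symm⟩, Building.smul_mem_apartments hh hA, Set.smul_set_mono hφ⟩
  · obtain ⟨h, hh, h'⟩ := htrans a ha b hb
    exact ⟨h, hh.1, h'⟩
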